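/- Let $(X,\mathcal B,\mu)$ be a probability space, let $T_n:X\to X$ ($n\ge 1$) be measurable maps, let $d\ge 1$, and let $g^i:X\to\mathbb R^d$ ($i\ge 0$) be measurable. Put $\mu(f)=\int f\,d\mu$, $\overline f=f-\mu(f)$ (entrywise), and $f^i=g^i\circ T_i\circ\cdots\circ T_1$. Let $N\ge 1$ and, for $n,k\ge 0$, $$\bar f^{\,n,k}=\sum_{0\le i<N,\ |i-n|=k}\bar f^i .$$ Let $\lambda_{\min}$ be the least eigenvalue of $\operatorname{Cov}_\mu\big(\sum_{i=0}^{N-1}\bar f^i\big)$, and assume that $\lambda_{\min}>1$. Let $b=\operatorname{Cov}_\mu\big(\sum_{i=0}^{N-1}\bar f^i\big)^{1/2}$ be the positive definite square root, and let $W=\sum_{i=0}^{N-1}b^{-1}\bar f^i$, so that $\operatorname{Cov}_\mu(W)=I$. Let $\|\cdot\|$ be the Euclidean norm, $\|\cdot\|_s$ the spectral norm of matrices, and $B_d(0,r)\subset\mathbb R^d$ the open ball. For $M\ge 1$ and a $C^1$ function $G:\mathbb R^d\times B_d(0,4M+1)\to\mathbb R^{d\times d}$ put $$\|G\|_\infty=\sup_{x,y}\|G(x,y)\|_s,\qquad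 \|\nabla G\|_\infty=\max_{1\le i\le 2d}\ \sup_{x,y}\|\partial_iG(x,y)\|_s .$$ Suppose that $\sup_{x\in X}\|g^i(x)\|\le M$ for $0\le i<N$, where $M\ge 1$, and that there are constants $C_1,C_2,C_3>0$ and a non-increasing function $\rho:\mathbb N\to[0,\infty)$ with $\lim_{n\to\infty}\rho(n)=0$ such that the following holds for all $0\le n,m\le N-1$. * (C1) For all $\alpha,\beta\in\{1,\dots,d\}$: $\ |\mu(\bar f^n_\alpha\bar f^m_\beta)|\le C_1\,\rho(|n-m|)$. * (C2) Whenever $m\le k\le N-1$ and $G:\mathbb R^d\times B_d(0,4M+1)\to\mathbb R^{d\times d}$ is a bounded $C^1$ function with bounded gradient, $$\Big|\mu\Big[(\bar f^n)^T\,G\Big(\sum_{0\le i<N,\ |i-n|>k}\bar f^i,\ \bar f^{\,n,k}\Big)\,\bar f^{\,n,m}\Big]\Big|\le C_2\,(\|G\|_\infty+\|\nabla G\|_\infty)\,\rho(m).$$ * (C3) Whenever $2m\le k\le N-1$ and $G$ is as in (C2), $$\Big|\mu\Big[(\bar f^n)^T\,\overline{G\Big(\sum_{0\le i<N,\ |i-n|>k}\bar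 f^i,\ \bar f^{\,n,k}\Big)}\,\bar f^{\,n,m}\Big]\Big|\le C_3\,(\|G\|_\infty+\|\nabla G\|_\infty)\,\rho(k-m).$$ Suppose moreover that $\rho$ is normalized so that $$\rho(1)\le 1\qquad\text{and}\qquad \sum_{m=1}^{N-1}\big(1+\log(\rho(m)^{-1})\big)\,m\,\rho(m)\ \ge\ 1,$$ where terms with $\rho(m)=0$ are read as $0$ (both hold, for instance, if $N\ge 2$ and $\rho(1)=1$). Then, for $Z\sim\mathcal N(0,I_{d\times d})$ and the Wasserstein distance $d_{\mathscr W}(Y_1,Y_2)=\sup_h|E\,h(Y_1)-E\,h(Y_2)|$, the supremum being over all $1$-Lipschitz $h:\mathbb R^d\to\mathbb R$, $$d_{\mathscr W}(W,Z)\le C_*\,N\,(1+\log N)\,\lambda_{\min}^{-3/2}\sum_{m=1}^{N-1}\big(1+\log(\rho(m)^{-1})\big)\,m\,\rho(m),$$ where $$C_*=\Big(\frac{8+16d}{d}\,\frac{\Gamma(\frac{1+d}{2})}{\Gamma(\frac d2)}+4M\sqrt d+2\Big)\,2019\,d^2\,4^d\,M^4\,\Big[(C_2+C_3)\big(1+\rho(0)^{-1}\big)\big(2\rho(0)+1\big)+C_1+1\Big].$$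 -/

import Mathlib

open MeasureTheory ProbabilityTheory Filter Topology
open scoped ENNReal MatrixOrder Matrix.Norms.L2Operator

/- The scope `Matrix.Norms.L2Operator` makes `‖A‖` the spectral norm of a real matrix `A`, that is,
its operator norm with respect to the Euclidean norm. -/

noncomputable section

namespace SelfNormCLT

/-- Euclidean space `ℝ^d`. -/
abbrev Vec (d : ℕ) : Type := EuclideanSpace ℝ (Fin d)

/-- The action of a `d × d` matrix on `ℝ^d`. -/
def mulVec {d : ℕ} (A : Matrix (Fin d) (Fin d) ℝ) (v : Vec d) : Vec d :=
  WithLp.toLp 2 (A.mulVec v.ofLp)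

/-- The bilinear expression `vᵀ A w`. -/
def bilin {d : ℕ} (v : Vec d) (A : Matrix (Fin d) (Fin d) ℝ) (w : Vec d) : ℝ :=
  dotProduct v.ofLp (A.mulVec w.ofLp)

section Sums

variable {X : Type*} {d : ℕ}

/-- The composition `T_i ∘ ⋯ ∘ T_1` (the identity for `i = 0`; the map `T 0` is never used). -/
def iter (T : ℕ → X → X) : ℕ → X → X
  | 0 => id
  | i + 1 => T (i + 1) ∘ iter T i

/-- `f^i = g^i ∘ T_i ∘ ⋯ ∘ T_1`. -/
def obs (T : ℕ → X → X) (g : ℕ → X → Vec d) (i : ℕ) (x : X) : Vec d :=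
  g i (iter T i x)

variable [MeasurableSpace X]

/-- The centred observable `f^i - μ(f^i)`. -/
def fbar (μ : Measure X) (T : ℕ → X → X) (g : ℕ → X → Vec d) (i : ℕ) (x : X) : Vec d :=
  obs T g i x - ∫ y, obs T g i y ∂μ

/-- The sum of the centred observables over `0 ≤ i < N`. -/
def total (μ : Measure X) (T : ℕ → X → X) (g : ℕ → X → Vec d) (N : ℕ) (x : X) : Vec d :=
  ∑ i ∈ Finset.range N, fbar μ T g i x

/-- The sum of the centred observables over `0 ≤ i < N` with `|i - n| = k`. -/
def fbarAt (μ : Measure X) (T : ℕ → X → X) (g : ℕ → X → Vec d) (N n k : ℕ) (x : X) : Vec d :=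
  ∑ i ∈ (Finset.range N).filter (fun i : ℕ => ((i : ℤ) - (n : ℤ)).natAbs = k), fbar μ T g i x

/-- The sum of the centred observables over `0 ≤ i < N` with `|i - n| > k`. -/
def fbarFar (μ : Measure X) (T : ℕ → X → X) (g : ℕ → X → Vec d) (N n k : ℕ) (x : X) : Vec d :=
  ∑ i ∈ (Finset.range N).filter (fun i : ℕ => k < ((i : ℤ) - (n : ℤ)).natAbs), fbar μ T g i x

/-- The covariance matrix of the sum of the centred observables. -/
def covMat (μ : Measure X) (T : ℕ → X → X) (g : ℕ → X → Vec d) (N : ℕ) :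
    Matrix (Fin d) (Fin d) ℝ :=
  Matrix.of fun α β =>
    covariance (fun x => total μ T g N x α) (fun x => total μ T g N x β) μ

/-- The self-normalizing matrix: the positive semidefinite square root of the covariance matrix. -/
def bMat (μ : Measure X) (T : ℕ → X → X) (g : ℕ → X → Vec d) (N : ℕ) :
    Matrix (Fin d) (Fin d) ℝ :=
  CFC.sqrt (covMat μ T g N)

/-- The self-normalized sum. -/
def W (μ : Measure X) (T : ℕ → X → X) (g : ℕ → X → Vec d) (N : ℕ) (x : X) : Vec d :=
  ∑ i ∈ Finset.range N, mulVec (bMat μ T g N)⁻¹ (fbar μ T g i x)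

/-- The least eigenvalue of the covariance matrix. The real spectrum of a symmetric matrix of size
`d ≥ 1` is its finite nonempty set of eigenvalues, so the infimum is a minimum. -/
def lambdaMin (μ : Measure X) (T : ℕ → X → X) (g : ℕ → X → Vec d) (N : ℕ) : ℝ :=
  sInf (spectrum ℝ (covMat μ T g N))

end Sums

section TestFunctions

variable {d : ℕ}

/-- The domain `ℝ^d × B_d(0, r)` with the open Euclidean ball of radius `r`. -/
def dom (d : ℕ) (r : ℝ) : Set (Vec d × Vec d) :=
  Set.univ ×ˢ Metric.ball 0 r

/-- The `2d` coordinate directions of `ℝ^d × ℝ^d`. -/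
def direction : Fin d ⊕ Fin d → Vec d × Vec d
  | Sum.inl i => (EuclideanSpace.single i 1, 0)
  | Sum.inr i => (0, EuclideanSpace.single i 1)

/-- The partial derivative of a matrix-valued function in the `i`-th of the `2d` directions. -/
def partialDeriv (G : Vec d × Vec d → Matrix (Fin d) (Fin d) ℝ) (i : Fin d ⊕ Fin d)
    (z : Vec d × Vec d) : Matrix (Fin d) (Fin d) ℝ :=
  fderiv ℝ G z (direction i)

/-- `G` is a bounded `C^1` function with bounded gradient on `ℝ^d × B_d(0, r)`; its values outside
of this open set play no role. -/
def IsTest (r : ℝ) (G : Vec d × Vec d → Matrix (Fin d) (Fin d) ℝ) : Prop :=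
  ContDiffOn ℝ 1 G (dom d r) ∧
  BddAbove (Set.range fun z : dom d r => ‖G z‖) ∧
  ∀ i, BddAbove (Set.range fun z : dom d r => ‖partialDeriv G i z‖)

/-- `‖G‖_∞`, the supremum of the spectral norm of `G` on `ℝ^d × B_d(0, r)`. -/
def supNorm (r : ℝ) (G : Vec d × Vec d → Matrix (Fin d) (Fin d) ℝ) : ℝ :=
  ⨆ z : dom d r, ‖G z‖

/-- `‖∇G‖_∞`, the maximum over the `2d` directions of the supremum of the spectral norm of the
partial derivative on `ℝ^d × B_d(0, r)`. -/
def gradNorm (r : ℝ) (G : Vec d × Vec d → Matrix (Fin d) (Fin d) ℝ) : ℝ :=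
  ⨆ i : Fin d ⊕ Fin d, ⨆ z : dom d r, ‖partialDeriv G i z‖

end TestFunctions

section Conditions

variable {X : Type*} [MeasurableSpace X] {d : ℕ}

/-- Decay of the correlations of the components. -/
def CondC1 (μ : Measure X) (T : ℕ → X → X) (g : ℕ → X → Vec d) (N : ℕ) (ρ : ℕ → ℝ)
    (C₁ : ℝ) : Prop :=
  ∀ n < N, ∀ m < N, ∀ α β : Fin d,
    |∫ x, fbar μ T g n x α * fbar μ T g m x β ∂μ| ≤ C₁ * ρ ((n : ℤ) - (m : ℤ)).natAbs

/-- The second mixing condition. -/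
def CondC2 (μ : Measure X) (T : ℕ → X → X) (g : ℕ → X → Vec d) (N : ℕ) (M : ℝ) (ρ : ℕ → ℝ)
    (C₂ : ℝ) : Prop :=
  ∀ n < N, ∀ m < N, ∀ k < N, m ≤ k →
    ∀ G : Vec d × Vec d → Matrix (Fin d) (Fin d) ℝ, IsTest (4 * M + 1) G →
      |∫ x, bilin (fbar μ T g n x) (G (fbarFar μ T g N n k x, fbarAt μ T g N n k x))
          (fbarAt μ T g N n m x) ∂μ|
        ≤ C₂ * (supNorm (4 * M + 1) G + gradNorm (4 * M + 1) G) * ρ m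

/-- The third mixing condition, in which the matrix is centred entrywise. -/
def CondC3 (μ : Measure X) (T : ℕ → X → X) (g : ℕ → X → Vec d) (N : ℕ) (M : ℝ) (ρ : ℕ → ℝ)
    (C₃ : ℝ) : Prop :=
  ∀ n < N, ∀ m < N, ∀ k < N, 2 * m ≤ k →
    ∀ G : Vec d × Vec d → Matrix (Fin d) (Fin d) ℝ, IsTest (4 * M + 1) G →
      |∫ x, bilin (fbar μ T g n x)
          (G (fbarFar μ T g N n k x, fbarAt μ T g N n k x)
            - Matrix.of fun α β =>
                ∫ y, G (fbarFar μ T g N n k y, fbarAt μ T g N n k y) α β ∂μ)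
          (fbarAt μ T g N n m x) ∂μ|
        ≤ C₃ * (supNorm (4 * M + 1) G + gradNorm (4 * M + 1) G) * ρ (k - m)

end Conditions

/-- The Wasserstein distance of two laws `P`, `Q`: the supremum of `|P(h) - Q(h)|` over all
`1`-Lipschitz functions `h`, as an extended nonnegative number. It is meant for laws with a finite
first moment, for which every Lipschitz function is integrable. -/
def wassersteinDist {E : Type*} [PseudoEMetricSpace E] [MeasurableSpace E] (P Q : Measure E) :
    ℝ≥0∞ :=
  ⨆ (h : E → ℝ) (_ : LipschitzWith 1 h), ENNReal.ofReal |∫ x, h x ∂P - ∫ x, h x ∂Q|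

/-- `∑_{m=1}^{N-1} (1 + log (1/ρ(m))) m ρ(m)`. A term with `ρ(m) = 0` is `0`. -/
def rhoSum (N : ℕ) (ρ : ℕ → ℝ) : ℝ :=
  ∑ m ∈ Finset.Ico 1 N, (1 + Real.log (ρ m)⁻¹) * m * ρ m

/-- The explicit constant of the bound; `ρ₀` stands for `ρ(0)`. -/
def Cstar (d : ℕ) (M ρ₀ C₁ C₂ C₃ : ℝ) : ℝ :=
  ((8 + 16 * (d : ℝ)) / d * (Real.Gamma ((1 + (d : ℝ)) / 2) / Real.Gamma ((d : ℝ) / 2))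
      + √(d : ℝ) * (4 * M) + 2)
    * (2019 * (d : ℝ) ^ 2 * 4 ^ d * M ^ 4)
    * ((C₂ + C₃) * (1 + ρ₀⁻¹) * (2 * ρ₀ + 1) + C₁ + 1)

end SelfNormCLT

end

open SelfNormCLT

/-!
The sum `S` of the centred observables is compared with a Gaussian vector by Stein's method along
the Gaussian interpolation `Φ(θ) = E ∫ h (cos θ • W + sin θ • z) dγ(z)`, which runs from `E h(W)` at
`θ = 0` to `∫ h dγ` at `θ = π / 2`.

*Interpolation.* Gaussian integration by parts (`integral_fderiv_stdGaussian`) turns `Φ'(θ)` into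
`-sin θ (E⟪W, F(W)⟫ - E tr (DF)(W))`, where `F` is a Gaussian average of `∇h`
(`hasDerivAt_interp`). Integrating by parts twice moves two of the three derivatives in `D²F` onto
the Gaussian density, so that the Lipschitz constant of `DF` is at most `(d + 1) cos² θ / sin² θ`
for every `h` with slopes at most `1` (`norm_gaussSmooth_fderiv_three_le`). Hence
`|Φ'(θ)| ≤ L cos θ / sin θ`, whose integral over `[θ₀, π / 2]` is `L log (1 / sin θ₀)`, while
stopping at `θ₀` costs at most `2 √d sin θ₀` (`abs_integral_sub_le_of_deriv`). With
`sin θ₀ = N⁻²` the logarithm is `2 log N` and the cost is absorbed because `λ_min ≤ (2MN)²`.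

*Stein bound.* With `P = b⁻¹`, the field `x ↦ P F(P x)` and its Jacobian `A` reduce everything to
`S`, and self-normalization means `tr (A(S) Cov S) = tr (DF)(W)`. For a bounded map `F` whose
Jacobian `A` is `K`-Lipschitz, `IsMixing.stein_bound` estimates the difference between
`E⟪S, F(S)⟫` and `E[Sᵀ (E A(S)) S]`. For each `n`, the observables are removed from `S` in order of
their distance from `n`; the resulting telescoping sums split the difference into

* Taylor remainders at distance `m`, controlled by the second mixing condition
  (`IsMixing.integral_taylor_le`);
* centred increments of `A` at distance `k > m`, which decouple from the window by the second
  condition if `k ≤ 2m` and by the third one otherwise (`IsMixing.integral_centred_le`), so that the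
  double sum collapses to a multiple of `∑ m ρ(m)`;
* differences of means of `A`, to which the second condition applies with constant matrices.

Only increments of `A` and their means occur as test functions, so only the Lipschitz constant `K`,
of order `λ_min ^ (-3/2)`, enters the bound, and not the size of `A`.

*Reduction.* Truncation and mollification show that test functions which are smooth with bounded
derivatives determine the Wasserstein distance (`wassersteinDist_le_of_isSmoothTest`).
-/

set_option maxSynthPendingDepth 3

/-! ### Gaussian integration by parts and Gaussian averages -/

open Real in
/-- The standard Gaussian law has the expected density, since the two characteristic functions
agree. -/
theorem stdGaussian_eq_withDensity {E : Type*} [NormedAddCommGroup E] [InnerProductSpace ℝ E]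
    [FiniteDimensional ℝ E] [MeasurableSpace E] [BorelSpace E] :
    stdGaussian E = volume.withDensity fun x : E =>
      ENNReal.ofReal ((2 * π) ^ (-(Module.finrank ℝ E : ℝ) / 2) * Real.exp (-‖x‖ ^ 2 / 2)) := by
  set κ : ℝ := (2 * π) ^ (-(Module.finrank ℝ E : ℝ) / 2) with hκ
  have hκ0 : 0 < κ := by positivity
  have hint : Integrable (fun x : E => κ * Real.exp (-‖x‖ ^ 2 / 2)) := by
    have := GaussianFourier.integrable_cexp_neg_mul_sq_norm_add (V := E) (b := 1 / 2)
      (by norm_num) 0 0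
    have h2 := this.re.const_mul κ
    refine h2.congr (ae_of_all _ fun x => ?_)
    have : (-(1/2 : ℂ) * ‖x‖ ^ 2 + 0 * (inner ℝ (0 : E) x : ℝ)) = ((-‖x‖ ^ 2 / 2 : ℝ) : ℂ) := by
      push_cast; ring
    simp only [this, ← Complex.ofReal_exp]
    rfl
  have hfin : IsFiniteMeasure (volume.withDensity fun x : E =>
      ENNReal.ofReal (κ * Real.exp (-‖x‖ ^ 2 / 2))) :=
    isFiniteMeasure_withDensity_ofReal hint.2
  refine Measure.ext_of_charFun ?_
  ext t
  rw [charFun_stdGaussian, charFun_apply, integral_withDensity_eq_integral_toReal_smul (by fun_prop)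
    (ae_of_all _ fun _ => ENNReal.ofReal_lt_top)]
  have key := GaussianFourier.integral_cexp_neg_mul_sq_norm_add (V := E) (b := 1 / 2)
    (by norm_num) Complex.I t
  have hcongr : ∀ x : E, (ENNReal.ofReal (κ * Real.exp (-‖x‖ ^ 2 / 2))).toReal •
      Complex.exp ((inner ℝ x t : ℝ) * Complex.I)
      = (κ : ℂ) * Complex.exp (-(1 / 2 : ℂ) * ‖x‖ ^ 2 + Complex.I * (inner ℝ t x : ℝ)) := by
    intro x
    rw [ENNReal.toReal_ofReal (by positivity), Complex.real_smul, Complex.exp_add,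
      real_inner_comm t x]
    push_cast
    rw [mul_assoc]
    congr 3
    · ring_nf
    · ring
  simp_rw [hcongr]
  rw [integral_const_mul]
  rw [key]
  have h1 : (π / (1 / 2) : ℂ) = ((2 * π : ℝ) : ℂ) := by push_cast; ring
  have h2 : (κ : ℂ) * ((2 * π : ℝ) : ℂ) ^ ((Module.finrank ℝ E : ℂ) / 2) = 1 := by
    have : ((2 * π : ℝ) : ℂ) ^ ((Module.finrank ℝ E : ℂ) / 2)
        = (((2 * π : ℝ) ^ ((Module.finrank ℝ E : ℝ) / 2) : ℝ) : ℂ) := by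
      rw [Complex.ofReal_cpow (by positivity)]; push_cast; rfl
    rw [this, ← Complex.ofReal_mul, hκ, ← Real.rpow_add (by positivity)]
    simp [neg_div]
  rw [h1, ← mul_assoc, h2, one_mul]
  congr 1
  simp
  ring

/-- Gaussian integration by parts (Stein's identity). -/
theorem integral_fderiv_stdGaussian {E : Type*} [NormedAddCommGroup E] [InnerProductSpace ℝ E]
    [FiniteDimensional ℝ E] [MeasurableSpace E] [BorelSpace E] {ψ : E → ℝ} {ψ' : E → E →L[ℝ] ℝ}
    (w : E) (hψ : ∀ z, HasFDerivAt ψ (ψ' z) z) (hi : Integrable ψ (stdGaussian E))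
    (hi' : Integrable (fun z => ψ' z w) (stdGaussian E))
    (hiw : Integrable (fun z => ψ z * inner ℝ z w) (stdGaussian E)) :
    ∫ z, ψ' z w ∂stdGaussian E = ∫ z, ψ z * inner ℝ z w ∂stdGaussian E := by
  set κ : ℝ := (2 * Real.pi) ^ (-(Module.finrank ℝ E : ℝ) / 2) with hκ
  have hκ0 : 0 < κ := by positivity
  set p : E → ℝ := fun x => κ * Real.exp (-‖x‖ ^ 2 / 2) with hp
  have hp0 : ∀ x, 0 ≤ p x := fun x => by positivity
  have hpm : Measurable fun x => ENNReal.ofReal (p x) := by fun_prop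
  have hpt : ∀ᵐ x : E, ENNReal.ofReal (p x) < ∞ := ae_of_all _ fun _ => ENNReal.ofReal_lt_top
  have hγ : stdGaussian E = volume.withDensity fun x : E => ENNReal.ofReal (p x) :=
    stdGaussian_eq_withDensity
  have hpd : ∀ x, HasFDerivAt p (-(p x) • innerSL ℝ x) x := by
    intro x
    have h1 : HasFDerivAt (fun x : E => -‖x‖ ^ 2 / 2) (-innerSL ℝ x) x := by
      have := (hasStrictFDerivAt_norm_sq x).hasFDerivAt.const_mul (-1 / 2 : ℝ)
      refine (this.congr_fderiv ?_).congr_of_eventuallyEq (Eventually.of_forall fun y => by ring_nf)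
      ext v; simp; ring
    have := (h1.exp).const_mul κ
    refine this.congr_fderiv ?_
    ext v; simp [hp]; ring
  rw [hγ] at hi hi' hiw ⊢
  rw [integrable_withDensity_iff_integrable_smul₀' hpm.aemeasurable hpt] at hi hi' hiw
  rw [integral_withDensity_eq_integral_toReal_smul hpm hpt,
    integral_withDensity_eq_integral_toReal_smul hpm hpt]
  simp only [ENNReal.toReal_ofReal (hp0 _), smul_eq_mul] at *
  have := integral_bilinear_hasFDerivAt_right_eq_neg_left_of_integrable (μ := volume)
    (B := ContinuousLinearMap.mul ℝ ℝ) (f := p) (g := ψ) (v := w)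
    (by refine hiw.neg.congr (ae_of_all _ fun x => ?_); simp; ring) hi' hi (fun x _ => hpd x)
    (fun x _ => hψ x)
  simp only [ContinuousLinearMap.mul_apply'] at this
  rw [this, ← integral_neg]
  congr 1; ext x; simp; ring

section Smoothing

variable {E F : Type*} [NormedAddCommGroup E] [InnerProductSpace ℝ E]
  [FiniteDimensional ℝ E] [MeasurableSpace E] [BorelSpace E] [NormedAddCommGroup F]
  [NormedSpace ℝ F]

/-- The Gaussian average `x ↦ ∫ q (c x + s z) dγ(z)`, an Ornstein–Uhlenbeck operator when
`c ^ 2 + s ^ 2 = 1`. -/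
noncomputable def gaussSmooth (c s : ℝ) (q : E → F) (x : E) : F :=
  ∫ z, q (c • x + s • z) ∂stdGaussian E

theorem integrable_norm_sq_stdGaussian : Integrable (fun z : E => ‖z‖ ^ 2) (stdGaussian E) := by
  have : MemLp id 2 (stdGaussian E) := IsGaussian.memLp_id _ 2 (by simp)
  exact this.integrable_norm_pow (by norm_num)

theorem integrable_norm_stdGaussian : Integrable (fun z : E => ‖z‖) (stdGaussian E) :=
  (IsGaussian.integrable_id (μ := stdGaussian E)).norm

omit [NormedSpace ℝ F] in
theorem integrable_of_bounded_continuous {Y : Type*} [TopologicalSpace Y] [MeasurableSpace Y]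
    [OpensMeasurableSpace Y] [SecondCountableTopologyEither Y F] {ν : Measure Y}
    [IsFiniteMeasure ν] {q : Y → F} (hq : Continuous q) {K : ℝ} (hK : ∀ x, ‖q x‖ ≤ K) :
    Integrable q ν :=
  Integrable.of_bound hq.aestronglyMeasurable K (ae_of_all _ hK)

theorem integrable_mul_inner_stdGaussian {q : E → ℝ} (hq : Continuous q) {K : ℝ}
    (hK : ∀ x, |q x| ≤ K) (w : E) :
    Integrable (fun z => q z * inner ℝ z w) (stdGaussian E) := by
  refine Integrable.bdd_mul (c := K) ?_ hq.aestronglyMeasurable (ae_of_all _ hK)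
  refine Integrable.mono' (integrable_norm_stdGaussian.mul_const ‖w‖)
    (by fun_prop) (ae_of_all _ fun z => ?_)
  exact abs_real_inner_le_norm z w

theorem integrable_mul_inner_inner_stdGaussian {q : E → ℝ} (hq : Continuous q) {K : ℝ}
    (hK : ∀ x, |q x| ≤ K) (w u : E) :
    Integrable (fun z => q z * inner ℝ z w * inner ℝ z u) (stdGaussian E) := by
  simp_rw [mul_assoc]
  refine Integrable.bdd_mul (c := K) ?_ hq.aestronglyMeasurable (ae_of_all _ hK)
  refine Integrable.mono' (integrable_norm_sq_stdGaussian.mul_const (‖w‖ * ‖u‖))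
    (by fun_prop) (ae_of_all _ fun z => ?_)
  rw [norm_mul]
  calc ‖inner ℝ z w‖ * ‖inner ℝ z u‖ ≤ (‖z‖ * ‖w‖) * (‖z‖ * ‖u‖) := by
        gcongr
        · exact abs_real_inner_le_norm z w
        · exact abs_real_inner_le_norm z u
    _ = _ := by ring

theorem integral_inner_sq_stdGaussian (w : E) :
    ∫ z, inner ℝ z w * inner ℝ z w ∂stdGaussian E = ‖w‖ ^ 2 := by
  have hb : ∀ x : E, |(fun _ : E => (1 : ℝ)) x| ≤ 1 := by simp
  have h1 := integrable_mul_inner_stdGaussian (q := fun _ : E => (1 : ℝ)) (by fun_prop) hb w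
  have h2 := integrable_mul_inner_inner_stdGaussian (q := fun _ : E => (1 : ℝ)) (by fun_prop)
    hb w w
  simp only [one_mul] at h1 h2
  have h := integral_fderiv_stdGaussian (ψ := fun z : E => inner ℝ z w)
    (ψ' := fun _ => innerSL ℝ w) w
    (fun z => by
      have := (innerSL ℝ w).hasFDerivAt (x := z)
      simpa [real_inner_comm] using this) h1 (integrable_const _) h2
  rw [← h]
  simp

theorem integral_norm_sq_stdGaussian :
    ∫ z, ‖z‖ ^ 2 ∂stdGaussian E = Module.finrank ℝ E := by
  let b := stdOrthonormalBasis ℝ E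
  have : ∀ z : E, ‖z‖ ^ 2 = ∑ i, inner ℝ z (b i) * inner ℝ z (b i) := by
    intro z
    rw [← b.sum_sq_norm_inner_left z]
    refine Finset.sum_congr rfl fun i _ => ?_
    rw [Real.norm_eq_abs, sq_abs, sq]
  simp_rw [this]
  rw [integral_finsetSum]
  · simp [integral_inner_sq_stdGaussian]
  · intro i _
    simpa using integrable_mul_inner_inner_stdGaussian (q := fun _ : E => (1 : ℝ)) (K := 1)
      (by fun_prop) (by simp) (b i) (b i)

omit [InnerProductSpace ℝ E] [FiniteDimensional ℝ E] [MeasurableSpace E] [BorelSpace E] in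
theorem integral_norm_le_sqrt {Y : Type*} [MeasurableSpace Y] {ν : Measure Y}
    [IsProbabilityMeasure ν] {q : Y → E} (hq : Integrable (fun y => ‖q y‖) ν)
    (hq2 : Integrable (fun y => ‖q y‖ ^ 2) ν) :
    ∫ y, ‖q y‖ ∂ν ≤ √(∫ y, ‖q y‖ ^ 2 ∂ν) := by
  apply Real.le_sqrt_of_sq_le
  set m := ∫ y, ‖q y‖ ∂ν with hm
  have h : ∫ y, (2 * m * ‖q y‖ - m ^ 2) ∂ν ≤ ∫ y, ‖q y‖ ^ 2 ∂ν :=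
    integral_mono ((hq.const_mul _).sub (integrable_const _)) hq2
      fun y => by nlinarith [sq_nonneg (‖q y‖ - m)]
  rw [integral_sub (hq.const_mul _) (integrable_const _), integral_const_mul, ← hm] at h
  simp only [integral_const, probReal_univ, smul_eq_mul, one_mul] at h
  linarith [sq_nonneg m]

variable [FiniteDimensional ℝ F]

theorem continuous_gaussSmooth {q : E → F} (c s : ℝ) (hq : Continuous q) {K : ℝ}
    (hK : ∀ x, ‖q x‖ ≤ K) : Continuous (gaussSmooth c s q) := by
  refine continuous_of_dominated (bound := fun _ => K) (fun x => ?_)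
    (fun x => ae_of_all _ fun z => hK _) (integrable_const _) (ae_of_all _ fun z => by fun_prop)
  exact Continuous.aestronglyMeasurable (by fun_prop)

omit [FiniteDimensional ℝ F] in
theorem norm_gaussSmooth_le {q : E → F} (c s : ℝ) {K : ℝ}
    (hK : ∀ x, ‖q x‖ ≤ K) (x : E) : ‖gaussSmooth c s q x‖ ≤ K := by
  have := norm_integral_le_of_norm_le_const (μ := stdGaussian E)
    (ae_of_all _ fun z => hK (c • x + s • z))
  simpa [gaussSmooth] using this

theorem hasFDerivAt_gaussSmooth {q : E → F} (c s : ℝ) (hq : ContDiff ℝ 1 q) {K K' : ℝ}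
    (hK : ∀ x, ‖q x‖ ≤ K) (hK' : ∀ x, ‖fderiv ℝ q x‖ ≤ K') (x : E) :
    HasFDerivAt (gaussSmooth c s q) (c • gaussSmooth c s (fderiv ℝ q) x) x := by
  have hq' : Continuous (fderiv ℝ q) := hq.continuous_fderiv one_ne_zero
  have := hasFDerivAt_integral_of_dominated_of_fderiv_le (μ := stdGaussian E) (𝕜 := ℝ)
    (F := fun x z => q (c • x + s • z)) (F' := fun x z => c • fderiv ℝ q (c • x + s • z))
    (x₀ := x) (s := Set.univ) (bound := fun _ => |c| * K') univ_mem
    (Eventually.of_forall fun x =>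
      Continuous.aestronglyMeasurable (hq.continuous.comp (by fun_prop)))
    (integrable_of_bounded_continuous (hq.continuous.comp (by fun_prop)) fun z => hK _)
    (Continuous.aestronglyMeasurable (by fun_prop))
    (ae_of_all _ fun z y _ => by
      rw [norm_smul]
      exact mul_le_mul_of_nonneg_left (hK' _) (abs_nonneg _))
    (integrable_const _)
    (ae_of_all _ fun z y _ => by
      have h1 : HasFDerivAt (fun x : E => c • x + s • z) (c • ContinuousLinearMap.id ℝ E) y :=
        ((hasFDerivAt_id y).const_smul c).add_const _
      have h2 := ((hq.differentiable one_ne_zero) (c • y + s • z)).hasFDerivAt.comp y h1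
      refine h2.congr_fderiv ?_
      ext v; simp)
  rw [integral_smul] at this
  exact this

end Smoothing

section ThirdDerivative

variable {E : Type*} [NormedAddCommGroup E] [InnerProductSpace ℝ E]
  [FiniteDimensional ℝ E] [MeasurableSpace E] [BorelSpace E]

/-- A smooth test function: `h` is `C³`, has slopes at most `1`, and `h` and its derivatives up
to order three are bounded by `K`. -/
structure IsSmoothTest (h : E → ℝ) (K : ℝ) : Prop where
  contDiff : ContDiff ℝ 3 h
  bound : ∀ x, ‖h x‖ ≤ K
  bound_one : ∀ x, ‖fderiv ℝ h x‖ ≤ 1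
  bound_two : ∀ x, ‖fderiv ℝ (fderiv ℝ h) x‖ ≤ K
  bound_three : ∀ x, ‖fderiv ℝ (fderiv ℝ (fderiv ℝ h)) x‖ ≤ K

namespace IsSmoothTest

variable {h : E → ℝ} {K : ℝ}

omit [MeasurableSpace E] [BorelSpace E] [FiniteDimensional ℝ E]

theorem contDiff_one (hh : IsSmoothTest h K) : ContDiff ℝ 2 (fderiv ℝ h) :=
  hh.contDiff.fderiv_right (by norm_num)

theorem contDiff_two (hh : IsSmoothTest h K) : ContDiff ℝ 1 (fderiv ℝ (fderiv ℝ h)) :=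
  hh.contDiff_one.fderiv_right (by norm_num)

theorem continuous_three (hh : IsSmoothTest h K) :
    Continuous (fderiv ℝ (fderiv ℝ (fderiv ℝ h))) :=
  hh.contDiff_two.continuous_fderiv one_ne_zero

end IsSmoothTest

omit [FiniteDimensional ℝ E] [MeasurableSpace E] [BorelSpace E] in
theorem hasFDerivAt_comp_smul_add {F : Type*} [NormedAddCommGroup F] [NormedSpace ℝ F] {q : E → F}
    (hq : ContDiff ℝ 1 q) (a : E) (s : ℝ) (z : E) :
    HasFDerivAt (fun z => q (a + s • z)) (s • fderiv ℝ q (a + s • z)) z := by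
  have h1 : HasFDerivAt (fun z : E => a + s • z) (s • ContinuousLinearMap.id ℝ E) z :=
    ((hasFDerivAt_id z).const_smul s).const_add _
  have h2 := ((hq.differentiable one_ne_zero) (a + s • z)).hasFDerivAt.comp z h1
  refine h2.congr_fderiv ?_
  ext v; simp

/-- One Gaussian integration by parts turns the second derivative of a test function into the
first. -/
theorem integral_fderiv_two_apply {h : E → ℝ} {K : ℝ} (hh : IsSmoothTest h K) (a : E) (s : ℝ)
    (w v : E) :
    s * ∫ z, fderiv ℝ (fderiv ℝ h) (a + s • z) w v ∂stdGaussian E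
      = ∫ z, fderiv ℝ h (a + s • z) v * inner ℝ z w ∂stdGaussian E := by
  have hc1 := hh.contDiff_one.continuous
  have hc2 := hh.contDiff_two.continuous
  have hb1 : ∀ z, |fderiv ℝ h (a + s • z) v| ≤ ‖v‖ := fun z =>
    ((fderiv ℝ h (a + s • z)).le_of_opNorm_le (hh.bound_one _) v).trans (by simp)
  have hb2 : ∀ z, |s * fderiv ℝ (fderiv ℝ h) (a + s • z) w v| ≤ |s| * (K * ‖w‖ * ‖v‖) := fun z => by
    rw [abs_mul]
    gcongr
    exact (fderiv ℝ (fderiv ℝ h) (a + s • z)).le_of_opNorm₂_le_of_le (hh.bound_two _) le_rfl le_rfl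
  have := integral_fderiv_stdGaussian (ψ := fun z => fderiv ℝ h (a + s • z) v)
    (ψ' := fun z => s • (fderiv ℝ (fderiv ℝ h) (a + s • z)).flip v) w
    (fun z => by
      have h1 := hasFDerivAt_comp_smul_add (hh.contDiff_one.of_le (by norm_num)) a s z
      exact (h1.clm_apply (hasFDerivAt_const v z)).congr_fderiv (by ext u; simp))
    (integrable_of_bounded_continuous (by fun_prop) hb1)
    (integrable_of_bounded_continuous (by simp; fun_prop) (fun z => by simpa using hb2 z))
    (integrable_mul_inner_stdGaussian (by fun_prop) hb1 w)
  rw [← this, ← integral_const_mul]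
  simp

/-- Two Gaussian integrations by parts turn the third derivative of a test function into the
first. -/
theorem integral_fderiv_three_apply {h : E → ℝ} {K : ℝ} (hh : IsSmoothTest h K) (a : E) (s : ℝ)
    (w u v : E) :
    s ^ 2 * ∫ z, fderiv ℝ (fderiv ℝ (fderiv ℝ h)) (a + s • z) w u v ∂stdGaussian E
      = ∫ z, fderiv ℝ h (a + s • z) v * (inner ℝ z w * inner ℝ z u - inner ℝ u w)
        ∂stdGaussian E := by
  have hc1 := hh.contDiff_one.continuous
  have hc2 := hh.contDiff_two.continuous
  have hc3 := hh.continuous_three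
  have hb1 : ∀ z, |fderiv ℝ h (a + s • z) v| ≤ ‖v‖ := fun z =>
    ((fderiv ℝ h (a + s • z)).le_of_opNorm_le (hh.bound_one _) v).trans (by simp)
  have hb2 : ∀ z, |fderiv ℝ (fderiv ℝ h) (a + s • z) u v| ≤ K * ‖u‖ * ‖v‖ := fun z =>
    (fderiv ℝ (fderiv ℝ h) (a + s • z)).le_of_opNorm₂_le_of_le (hh.bound_two _) le_rfl le_rfl
  have hb2' : ∀ z, |s * fderiv ℝ (fderiv ℝ h) (a + s • z) u v| ≤ |s| * (K * ‖u‖ * ‖v‖) :=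
    fun z => by rw [abs_mul]; gcongr; exact hb2 z
  have hb3 : ∀ z, |s * fderiv ℝ (fderiv ℝ (fderiv ℝ h)) (a + s • z) w u v|
      ≤ |s| * (K * ‖w‖ * ‖u‖ * ‖v‖) := fun z => by
    rw [abs_mul]
    gcongr
    refine ((fderiv ℝ (fderiv ℝ (fderiv ℝ h)) (a + s • z) w).le_opNorm₂ u v).trans ?_
    gcongr
    exact (fderiv ℝ (fderiv ℝ (fderiv ℝ h)) (a + s • z)).le_of_opNorm_le (hh.bound_three _) w
  have e1 := integral_fderiv_stdGaussian
    (ψ := fun z => fderiv ℝ (fderiv ℝ h) (a + s • z) u v)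
    (ψ' := fun z => s • ((fderiv ℝ (fderiv ℝ (fderiv ℝ h)) (a + s • z)).flip u).flip v) w
    (fun z => by
      have h1 := hasFDerivAt_comp_smul_add hh.contDiff_two a s z
      exact ((h1.clm_apply (hasFDerivAt_const u z)).clm_apply
        (hasFDerivAt_const v z)).congr_fderiv (by ext u; simp))
    (integrable_of_bounded_continuous (by fun_prop) hb2)
    (integrable_of_bounded_continuous (by simp; fun_prop) (fun z => by simpa using hb3 z))
    (integrable_mul_inner_stdGaussian (by fun_prop) hb2 w)
  have i2 : Integrable (fun z => s * fderiv ℝ (fderiv ℝ h) (a + s • z) u v * inner ℝ z w)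
      (stdGaussian E) := integrable_mul_inner_stdGaussian (by fun_prop) hb2' w
  have i1 : Integrable (fun z => fderiv ℝ h (a + s • z) v * inner ℝ u w) (stdGaussian E) :=
    (integrable_of_bounded_continuous (by fun_prop) hb1).mul_const _
  have e2 := integral_fderiv_stdGaussian
    (ψ := fun z => fderiv ℝ h (a + s • z) v * inner ℝ z w)
    (ψ' := fun z => (fderiv ℝ h (a + s • z) v) • innerSL ℝ w
      + (inner ℝ z w : ℝ) • (s • (fderiv ℝ (fderiv ℝ h) (a + s • z)).flip v)) u
    (fun z => by
      have h1 := hasFDerivAt_comp_smul_add (hh.contDiff_one.of_le (by norm_num)) a s z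
      have h2 := (h1.clm_apply (hasFDerivAt_const v z))
      have h3 : HasFDerivAt (fun z : E => (inner ℝ z w : ℝ)) (innerSL ℝ w) z := by
        have := (innerSL ℝ w).hasFDerivAt (x := z)
        simpa [real_inner_comm] using this
      exact (h2.mul h3).congr_fderiv (by ext u; simp))
    (integrable_mul_inner_stdGaussian (by fun_prop) hb1 w)
    ((i1.add i2).congr (ae_of_all _ fun z => by simp [real_inner_comm]; ring))
    (integrable_mul_inner_inner_stdGaussian (by fun_prop) hb1 w u)
  have i3 := integrable_mul_inner_inner_stdGaussian (q := fun z => fderiv ℝ h (a + s • z) v)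
    (by fun_prop) hb1 w u
  have e2' : ∫ z, s * fderiv ℝ (fderiv ℝ h) (a + s • z) u v * inner ℝ z w ∂stdGaussian E
      = ∫ z, fderiv ℝ h (a + s • z) v * (inner ℝ z w * inner ℝ z u - inner ℝ u w)
        ∂stdGaussian E := by
    have : ∀ z : E, fderiv ℝ h (a + s • z) v * (inner ℝ z w * inner ℝ z u - inner ℝ u w)
        = fderiv ℝ h (a + s • z) v * inner ℝ z w * inner ℝ z u
          - fderiv ℝ h (a + s • z) v * inner ℝ u w := fun z => by ring
    simp_rw [this]
    rw [integral_sub i3 i1, ← e2, eq_sub_iff_add_eq, ← integral_add i2 i1]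
    congr 1; ext z; simp [real_inner_comm]; ring
  rw [← e2']
  simp_rw [mul_assoc]
  rw [integral_const_mul, ← e1, ← integral_const_mul, ← integral_const_mul]
  congr 1; ext z; simp; ring

/-- The Gaussian average of the third derivative of a test function is bounded in terms of its
slopes alone. -/
theorem norm_gaussSmooth_fderiv_three_le {h : E → ℝ} {K : ℝ} (hh : IsSmoothTest h K) (c : ℝ)
    {s : ℝ} (hs : 0 < s) (x : E) :
    ‖gaussSmooth c s (fderiv ℝ (fderiv ℝ (fderiv ℝ h))) x‖ ≤ (Module.finrank ℝ E + 1) / s ^ 2 := by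
  have hi : Integrable (fun z => fderiv ℝ (fderiv ℝ (fderiv ℝ h)) (c • x + s • z))
      (stdGaussian E) := integrable_of_bounded_continuous
        (hh.continuous_three.comp (by fun_prop)) fun z => hh.bound_three _
  have key : ∀ w u v : E, |gaussSmooth c s (fderiv ℝ (fderiv ℝ (fderiv ℝ h))) x w u v|
      ≤ (Module.finrank ℝ E + 1) / s ^ 2 * ‖w‖ * ‖u‖ * ‖v‖ := by
    intro w u v
    have e : gaussSmooth c s (fderiv ℝ (fderiv ℝ (fderiv ℝ h))) x w u v
        = ∫ z, fderiv ℝ (fderiv ℝ (fderiv ℝ h)) (c • x + s • z) w u v ∂stdGaussian E := by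
      rw [gaussSmooth, ContinuousLinearMap.integral_apply hi,
        ContinuousLinearMap.integral_apply (hi.apply_continuousLinearMap w),
        ContinuousLinearMap.integral_apply
          ((hi.apply_continuousLinearMap w).apply_continuousLinearMap u)]
    have e2 := integral_fderiv_three_apply hh (c • x) s w u v
    have b : |∫ z, fderiv ℝ h (c • x + s • z) v * (inner ℝ z w * inner ℝ z u - inner ℝ u w)
        ∂stdGaussian E| ≤ ∫ z, (‖z‖ ^ 2 + 1) * (‖w‖ * ‖u‖ * ‖v‖) ∂stdGaussian E := by
      refine norm_integral_le_of_norm_le (f := fun z => fderiv ℝ h (c • x + s • z) v *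
        (inner ℝ z w * inner ℝ z u - inner ℝ u w))
        ((integrable_norm_sq_stdGaussian.add (integrable_const _)).mul_const _)
        (ae_of_all _ fun z => ?_)
      rw [norm_mul]
      calc ‖fderiv ℝ h (c • x + s • z) v‖ * ‖inner ℝ z w * inner ℝ z u - inner ℝ u w‖
          ≤ ‖v‖ * ((‖z‖ * ‖w‖) * (‖z‖ * ‖u‖) + ‖u‖ * ‖w‖) := by
            gcongr
            · exact ((fderiv ℝ h _).le_of_opNorm_le (hh.bound_one _) v).trans (by simp)
            · refine (norm_sub_le _ _).trans ?_
              rw [norm_mul]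
              gcongr
              · exact abs_real_inner_le_norm z w
              · exact abs_real_inner_le_norm z u
              · exact abs_real_inner_le_norm u w
        _ = _ := by ring
    -- The right-hand side is `E (‖z‖ ^ 2 + 1) = d + 1` times the norms of the directions.
    rw [integral_mul_const, integral_add integrable_norm_sq_stdGaussian (integrable_const _),
      integral_norm_sq_stdGaussian, ← e2, ← e, abs_mul, abs_of_pos (by positivity : 0 < s ^ 2)] at b
    simp only [integral_const, probReal_univ, smul_eq_mul, one_mul] at b
    rw [div_mul_eq_mul_div, div_mul_eq_mul_div, div_mul_eq_mul_div, le_div_iff₀ (by positivity)]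
    linarith
  refine ContinuousLinearMap.opNorm_le_bound _ (by positivity) fun w => ?_
  exact ContinuousLinearMap.opNorm_le_bound₂ _ (by positivity) fun u v => key w u v

end ThirdDerivative

/-! ### Test functions and the observables around a fixed index -/

section Bilin

variable {d : ℕ}

theorem bilin_eq_inner (v : Vec d) (A : Matrix (Fin d) (Fin d) ℝ) (w : Vec d) :
    bilin v A w = inner ℝ v (mulVec A w) := by
  simp [bilin, mulVec, PiLp.inner_apply, dotProduct, mul_comm]

theorem norm_mulVec_le (A : Matrix (Fin d) (Fin d) ℝ) (w : Vec d) :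
    ‖mulVec A w‖ ≤ ‖A‖ * ‖w‖ :=
  Matrix.l2_opNorm_mulVec A w

theorem abs_bilin_le (v : Vec d) (A : Matrix (Fin d) (Fin d) ℝ) (w : Vec d) :
    |bilin v A w| ≤ ‖v‖ * (‖A‖ * ‖w‖) := by
  rw [bilin_eq_inner]
  exact (abs_real_inner_le_norm _ _).trans (by gcongr; exact norm_mulVec_le A w)

theorem continuous_bilin :
    Continuous fun p : Vec d × Matrix (Fin d) (Fin d) ℝ × Vec d => bilin p.1 p.2.1 p.2.2 := by
  unfold bilin
  refine Continuous.dotProduct (by fun_prop) (Continuous.matrix_mulVec (by fun_prop) (by fun_prop))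

theorem bilin_sub_mat (v : Vec d) (A B : Matrix (Fin d) (Fin d) ℝ) (w : Vec d) :
    bilin v (A - B) w = bilin v A w - bilin v B w := by
  simp [bilin, Matrix.sub_mulVec, dotProduct_sub]

theorem bilin_sum_left {ι : Type*} (s : Finset ι) (v : ι → Vec d) (A : Matrix (Fin d) (Fin d) ℝ)
    (w : Vec d) : bilin (∑ i ∈ s, v i) A w = ∑ i ∈ s, bilin (v i) A w := by
  simp [bilin_eq_inner, sum_inner]

theorem bilin_sum_mat {ι : Type*} (s : Finset ι) (v : Vec d)
    (A : ι → Matrix (Fin d) (Fin d) ℝ) (w : Vec d) :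
    bilin v (∑ i ∈ s, A i) w = ∑ i ∈ s, bilin v (A i) w := by
  simp [bilin, Matrix.sum_mulVec, dotProduct_sum]

theorem bilin_sum_right {ι : Type*} (s : Finset ι) (v : Vec d) (A : Matrix (Fin d) (Fin d) ℝ)
    (w : ι → Vec d) : bilin v A (∑ i ∈ s, w i) = ∑ i ∈ s, bilin v A (w i) := by
  simp [bilin, Matrix.mulVec_sum, dotProduct_sum]

end Bilin

section TestFunctions

variable {d : ℕ} {A : Vec d → Matrix (Fin d) (Fin d) ℝ} {K r : ℝ}

theorem norm_direction_le (i : Fin d ⊕ Fin d) :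
    ‖(direction i).1‖ + ‖(direction i).2‖ ≤ 1 := by
  rcases i with i | i <;> simp [direction]

theorem hasFDerivAt_increment (hA : ContDiff ℝ 1 A) (u : ℝ) (z : Vec d × Vec d) :
    HasFDerivAt (fun z : Vec d × Vec d => A (z.1 + u • z.2) - A z.1)
      ((fderiv ℝ A (z.1 + u • z.2)).comp
          (ContinuousLinearMap.fst ℝ _ _ + u • ContinuousLinearMap.snd ℝ _ _)
        - (fderiv ℝ A z.1).comp (ContinuousLinearMap.fst ℝ _ _)) z := by
  have hd := hA.differentiable one_ne_zero
  have h1 : HasFDerivAt (fun z : Vec d × Vec d => z.1 + u • z.2)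
      (ContinuousLinearMap.fst ℝ _ _ + u • ContinuousLinearMap.snd ℝ _ _) z :=
    hasFDerivAt_fst.add (hasFDerivAt_snd.const_smul u)
  exact ((hd _).hasFDerivAt.comp z h1).sub ((hd _).hasFDerivAt.comp z hasFDerivAt_fst)

/-- The increments of a `K`-Lipschitz `C¹` matrix function are admissible test functions whose
norms are controlled by `K`, irrespective of the size of the function itself. -/
theorem isTest_increment (hA : ContDiff ℝ 1 A) (hK : ∀ x, ‖fderiv ℝ A x‖ ≤ K) (hr : 0 ≤ r)
    {u : ℝ} (hu0 : 0 ≤ u) (hu1 : u ≤ 1) :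
    IsTest r (fun z : Vec d × Vec d => A (z.1 + u • z.2) - A z.1) ∧
    supNorm r (fun z : Vec d × Vec d => A (z.1 + u • z.2) - A z.1) ≤ K * r ∧
    gradNorm r (fun z : Vec d × Vec d => A (z.1 + u • z.2) - A z.1) ≤ 2 * K := by
  have hK0 : 0 ≤ K := (norm_nonneg _).trans (hK 0)
  have hd := hA.differentiable one_ne_zero
  have hs : ∀ z : dom d r, ‖A (z.1.1 + u • z.1.2) - A z.1.1‖ ≤ K * r := by
    rintro ⟨⟨x, y⟩, hz⟩
    have hy : ‖y‖ < r := by simpa [dom] using hz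
    have := convex_univ.norm_image_sub_le_of_norm_fderiv_le (𝕜 := ℝ) (f := A) (C := K)
      (fun x _ => hd x) (fun x _ => hK x) (Set.mem_univ x) (Set.mem_univ (x + u • y))
    refine this.trans ?_
    gcongr
    rw [add_sub_cancel_left, norm_smul, Real.norm_of_nonneg hu0]
    nlinarith [norm_nonneg y]
  have hg : ∀ i, ∀ z : dom d r,
      ‖partialDeriv (fun z : Vec d × Vec d => A (z.1 + u • z.2) - A z.1) i z‖ ≤ 2 * K := by
    intro i z
    rw [partialDeriv, (hasFDerivAt_increment hA u z.1).fderiv]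
    have hi := norm_direction_le i
    have n1 := norm_nonneg (direction i).1
    have n2 := norm_nonneg (direction i).2
    simp only [sub_apply, ContinuousLinearMap.comp_apply, add_apply, smul_apply,
      ContinuousLinearMap.coe_fst', ContinuousLinearMap.coe_snd']
    calc _ ≤ K * (‖(direction i).1‖ + 1 * ‖(direction i).2‖) + K * ‖(direction i).1‖ := by
          refine (norm_sub_le _ _).trans (add_le_add ?_ ?_)
          · refine ContinuousLinearMap.le_of_opNorm_le_of_le _ (hK _) ((norm_add_le _ _).trans ?_)
            rw [norm_smul, Real.norm_of_nonneg hu0]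
            gcongr
          · exact ContinuousLinearMap.le_of_opNorm_le _ (hK _) _
      _ ≤ 2 * K := by nlinarith
  refine ⟨⟨?_, ⟨K * r, ?_⟩, fun i => ⟨2 * K, ?_⟩⟩, ?_, ?_⟩
  · exact ContDiff.contDiffOn ((hA.comp (by fun_prop)).sub (hA.comp (by fun_prop)))
  · rintro _ ⟨z, rfl⟩; exact hs z
  · rintro _ ⟨z, rfl⟩; exact hg i z
  · exact Real.iSup_le hs (by positivity)
  · exact Real.iSup_le (fun i => Real.iSup_le (hg i) (by positivity)) (by positivity)

theorem isTest_const (B : Matrix (Fin d) (Fin d) ℝ) :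
    IsTest r (fun _ : Vec d × Vec d => B) ∧ supNorm r (fun _ : Vec d × Vec d => B) ≤ ‖B‖ ∧
      gradNorm r (fun _ : Vec d × Vec d => B) ≤ 0 := by
  have hg : ∀ i, ∀ z : dom d r, ‖partialDeriv (fun _ : Vec d × Vec d => B) i z‖ ≤ 0 := by
    intro i z
    simp [partialDeriv]
  refine ⟨⟨contDiffOn_const, ⟨‖B‖, ?_⟩, fun i => ⟨0, ?_⟩⟩, ?_, ?_⟩
  · rintro _ ⟨z, rfl⟩; exact le_rfl
  · rintro _ ⟨z, rfl⟩; exact hg i z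
  · exact Real.iSup_le (fun _ => le_rfl) (norm_nonneg _)
  · exact Real.iSup_le (fun i => Real.iSup_le (hg i) le_rfl) le_rfl

end TestFunctions

section Window

variable {X : Type*} [MeasurableSpace X] {d : ℕ}

/-- The sum of the centred observables over `0 ≤ i < N` with `|i - n| ≥ j`. -/
noncomputable def outer (μ : Measure X) (T : ℕ → X → X) (g : ℕ → X → Vec d) (N n j : ℕ) (x : X) :
    Vec d :=
  ∑ i ∈ (Finset.range N).filter (fun i : ℕ => j ≤ ((i : ℤ) - (n : ℤ)).natAbs), fbar μ T g i x

variable {μ : Measure X} {T : ℕ → X → X} {g : ℕ → X → Vec d} {N : ℕ}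

theorem outer_zero (n : ℕ) (x : X) : outer μ T g N n 0 x = total μ T g N x := by
  simp [outer, total]

theorem outer_succ (n j : ℕ) (x : X) : outer μ T g N n (j + 1) x = fbarFar μ T g N n j x := by
  simp [outer, fbarFar]

theorem outer_eq_add (n j : ℕ) (x : X) :
    outer μ T g N n j x = outer μ T g N n (j + 1) x + fbarAt μ T g N n j x := by
  unfold outer fbarAt
  rw [← Finset.sum_union]
  · congr 1
    ext i
    simp only [Finset.mem_filter, Finset.mem_union, Finset.mem_range]
    omega
  · rw [Finset.disjoint_filter]
    intro i _ h
    omega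

theorem outer_eq_add_smul (n k : ℕ) (x : X) : outer μ T g N n k x =
    outer μ T g N n (k + 1) x + (1 : ℝ) • fbarAt μ T g N n k x := by
  rw [one_smul, outer_eq_add]

theorem outer_self {n : ℕ} (hn : n < N) (x : X) : outer μ T g N n N x = 0 := by
  unfold outer
  rw [Finset.filter_false_of_mem, Finset.sum_empty]
  intro i hi
  rw [Finset.mem_range] at hi
  omega

theorem total_eq_sum_fbarAt {n : ℕ} (hn : n < N) (x : X) :
    total μ T g N x = ∑ m ∈ Finset.range N, fbarAt μ T g N n m x := by
  rw [← outer_zero n, ← sub_zero (outer μ T g N n 0 x),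
    ← outer_self (μ := μ) (T := T) (g := g) hn x,
    ← Finset.sum_range_sub' (fun j => outer μ T g N n j x)]
  refine Finset.sum_congr rfl fun m _ => ?_
  rw [outer_eq_add n m, add_sub_cancel_left]

end Window

section Bounds

variable {X : Type*} [MeasurableSpace X] {d : ℕ} {μ : Measure X} {T : ℕ → X → X}
  {g : ℕ → X → Vec d} {N : ℕ} {M : ℝ}

theorem measurable_iter (hT : ∀ i, 1 ≤ i → Measurable (T i)) (i : ℕ) : Measurable (iter T i) := by
  induction i with
  | zero => exact measurable_id
  | succ i ih => exact (hT (i + 1) (by omega)).comp ih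

theorem measurable_obs (hT : ∀ i, 1 ≤ i → Measurable (T i)) (hg : ∀ i, Measurable (g i)) (i : ℕ) :
    Measurable (obs T g i) :=
  (hg i).comp (measurable_iter hT i)

theorem measurable_fbar (hT : ∀ i, 1 ≤ i → Measurable (T i)) (hg : ∀ i, Measurable (g i)) (i : ℕ) :
    Measurable (fbar μ T g i) :=
  (measurable_obs hT hg i).sub_const _

theorem measurable_total (hT : ∀ i, 1 ≤ i → Measurable (T i)) (hg : ∀ i, Measurable (g i)) (N : ℕ) :
    Measurable (total μ T g N) :=
  Finset.measurable_fun_sum _ fun i _ => measurable_fbar hT hg i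

theorem measurable_fbarAt (hT : ∀ i, 1 ≤ i → Measurable (T i)) (hg : ∀ i, Measurable (g i))
    (N n k : ℕ) : Measurable (fbarAt μ T g N n k) :=
  Finset.measurable_fun_sum _ fun i _ => measurable_fbar hT hg i

theorem measurable_outer (hT : ∀ i, 1 ≤ i → Measurable (T i)) (hg : ∀ i, Measurable (g i))
    (N n k : ℕ) : Measurable (outer μ T g N n k) :=
  Finset.measurable_fun_sum _ fun i _ => measurable_fbar hT hg i

variable [IsProbabilityMeasure μ]

theorem norm_fbar_le (hgM : ∀ i < N, ∀ x, ‖g i x‖ ≤ M) {i : ℕ} (hi : i < N) (x : X) :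
    ‖fbar μ T g i x‖ ≤ 2 * M := by
  have h1 : ‖∫ y, obs T g i y ∂μ‖ ≤ M := by
    have := norm_integral_le_of_norm_le_const (μ := μ) (ae_of_all _ fun y => hgM i hi (iter T i y))
    simpa [obs] using this
  calc _ ≤ ‖obs T g i x‖ + ‖∫ y, obs T g i y ∂μ‖ := norm_sub_le _ _
    _ ≤ M + M := add_le_add (hgM i hi _) h1
    _ = 2 * M := by ring

theorem norm_total_le (hgM : ∀ i < N, ∀ x, ‖g i x‖ ≤ M) (x : X) :
    ‖total μ T g N x‖ ≤ 2 * M * N := by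
  refine (norm_sum_le_of_le _ fun i hi => norm_fbar_le hgM (Finset.mem_range.1 hi) x).trans ?_
  simp [mul_comm]

theorem norm_fbarAt_le (hM : 0 ≤ M) (hgM : ∀ i < N, ∀ x, ‖g i x‖ ≤ M) (n k : ℕ) (x : X) :
    ‖fbarAt μ T g N n k x‖ ≤ 4 * M := by
  have hc : ((Finset.range N).filter (fun i : ℕ => ((i : ℤ) - (n : ℤ)).natAbs = k)).card ≤ 2 := by
    refine (Finset.card_le_card (t := {n - k, n + k}) fun i hi => ?_).trans Finset.card_le_two
    simp only [Finset.mem_filter, Finset.mem_insert, Finset.mem_singleton] at hi ⊢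
    omega
  refine (norm_sum_le_of_le _ fun i hi =>
    norm_fbar_le hgM (Finset.mem_range.1 (Finset.mem_filter.1 hi).1) x).trans ?_
  rw [Finset.sum_const, nsmul_eq_mul]
  calc _ ≤ (2 : ℝ) * (2 * M) := by gcongr; exact_mod_cast hc
    _ = 4 * M := by ring

theorem integral_fbar (hT : ∀ i, 1 ≤ i → Measurable (T i)) (hg : ∀ i, Measurable (g i))
    (hgM : ∀ i < N, ∀ x, ‖g i x‖ ≤ M) {i : ℕ} (hi : i < N) : ∫ x, fbar μ T g i x ∂μ = 0 := by
  have : Integrable (obs T g i) μ := Integrable.of_bound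
    (measurable_obs hT hg i).aestronglyMeasurable M (ae_of_all _ fun x => hgM i hi _)
  unfold fbar
  rw [integral_sub this (integrable_const _)]
  simp

end Bounds

section MatrixIntegral

variable {X : Type*} [MeasurableSpace X] {d : ℕ} {μ : Measure X}

theorem matrix_integral_apply {B : X → Matrix (Fin d) (Fin d) ℝ} (hB : Integrable B μ)
    (α β : Fin d) : (∫ x, B x ∂μ) α β = ∫ x, B x α β ∂μ := by
  have := (LinearMap.toContinuousLinearMap
    (Matrix.entryLinearMap ℝ ℝ α β : Matrix (Fin d) (Fin d) ℝ →ₗ[ℝ] ℝ)).integral_comp_comm hB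
  simpa using this.symm

theorem of_integral {B : X → Matrix (Fin d) (Fin d) ℝ} (hB : Integrable B μ) :
    (Matrix.of fun α β => ∫ x, B x α β ∂μ) = ∫ x, B x ∂μ := by
  ext α β
  rw [matrix_integral_apply hB]; rfl

theorem integrable_bilin [IsFiniteMeasure μ] {v w : X → Vec d}
    {B : X → Matrix (Fin d) (Fin d) ℝ} (hv : Measurable v) (hw : Measurable w)
    (hB : AEStronglyMeasurable B μ) {a b c : ℝ} (ha : ∀ x, ‖v x‖ ≤ a)
    (hb : ∀ x, ‖B x‖ ≤ b) (hc : ∀ x, ‖w x‖ ≤ c) :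
    Integrable (fun x => bilin (v x) (B x) (w x)) μ := by
  refine Integrable.of_bound (C := a * (b * c)) ?_ (ae_of_all _ fun x => ?_)
  · exact continuous_bilin.comp_aestronglyMeasurable
      (hv.aestronglyMeasurable.prodMk (hB.prodMk hw.aestronglyMeasurable))
  · have := (norm_nonneg _).trans (ha x)
    have := (norm_nonneg _).trans (hb x)
    exact (abs_bilin_le _ _ _).trans (by gcongr <;> simp [*])

end MatrixIntegral

/-! ### The Stein bound under the mixing conditions -/

/-- The standing hypotheses under which the Taylor expansion around a fixed index is carried out:
bounded measurable observables satisfying the second and third mixing conditions. -/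
structure IsMixing {X : Type*} [MeasurableSpace X] {d : ℕ} (μ : Measure X) (T : ℕ → X → X)
    (g : ℕ → X → Vec d) (N : ℕ) (M : ℝ) (ρ : ℕ → ℝ) (C₂ C₃ : ℝ) : Prop where
  measurable_map : ∀ i, 1 ≤ i → Measurable (T i)
  measurable_obs : ∀ i, Measurable (g i)
  one_le : 1 ≤ M
  norm_le : ∀ i < N, ∀ x, ‖g i x‖ ≤ M
  rate_nonneg : ∀ n, 0 ≤ ρ n
  nonneg₂ : 0 ≤ C₂
  nonneg₃ : 0 ≤ C₃
  cond₂ : CondC2 μ T g N M ρ C₂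
  cond₃ : CondC3 μ T g N M ρ C₃

/-- A bounded `C¹` matrix function with Lipschitz constant `K`. -/
structure IsLipMatrix {d : ℕ} (A : Vec d → Matrix (Fin d) (Fin d) ℝ) (KA K : ℝ) : Prop where
  contDiff : ContDiff ℝ 1 A
  norm_le : ∀ x, ‖A x‖ ≤ KA
  norm_fderiv_le : ∀ x, ‖fderiv ℝ A x‖ ≤ K

namespace IsLipMatrix

variable {X : Type*} [MeasurableSpace X] {d : ℕ} {μ : Measure X}
  {A : Vec d → Matrix (Fin d) (Fin d) ℝ} {KA K : ℝ}

theorem lip_nonneg (hA : IsLipMatrix A KA K) : 0 ≤ K :=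
  (norm_nonneg _).trans (hA.norm_fderiv_le 0)

theorem norm_sub_le (hA : IsLipMatrix A KA K) (x y : Vec d) : ‖A x - A y‖ ≤ K * ‖x - y‖ :=
  convex_univ.norm_image_sub_le_of_norm_fderiv_le (𝕜 := ℝ) (f := A) (C := K)
      (fun x _ => hA.contDiff.differentiable one_ne_zero x) (fun x _ => hA.norm_fderiv_le x)
      (Set.mem_univ y) (Set.mem_univ x)

theorem aestronglyMeasurable_comp (hA : IsLipMatrix A KA K) {v : X → Vec d} (hv : Measurable v) :
    AEStronglyMeasurable (fun x => A (v x)) μ :=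
  hA.contDiff.continuous.comp_aestronglyMeasurable hv.aestronglyMeasurable

theorem integrable_comp [IsFiniteMeasure μ] (hA : IsLipMatrix A KA K) {v : X → Vec d}
    (hv : Measurable v) :
    Integrable (fun x => A (v x)) μ :=
  Integrable.of_bound (hA.aestronglyMeasurable_comp hv) KA (ae_of_all _ fun _ => hA.norm_le _)

end IsLipMatrix

namespace IsMixing

variable {X : Type*} [MeasurableSpace X] {d : ℕ} {μ : Measure X}
  {T : ℕ → X → X} {g : ℕ → X → Vec d} {N : ℕ} {M : ℝ} {ρ : ℕ → ℝ} {C₂ C₃ : ℝ}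
  {A : Vec d → Matrix (Fin d) (Fin d) ℝ} {KA K : ℝ}

/-- The second mixing condition for a constant matrix: the decay of the correlations of the
observables themselves. -/
theorem integral_const_le (S : IsMixing μ T g N M ρ C₂ C₃) {n m : ℕ} (hn : n < N) (hm : m < N)
    (B : Matrix (Fin d) (Fin d) ℝ) :
    |∫ x, bilin (fbar μ T g n x) B (fbarAt μ T g N n m x) ∂μ| ≤ C₂ * ‖B‖ * ρ m := by
  obtain ⟨h1, h2, h3⟩ := isTest_const (r := 4 * M + 1) B
  refine (S.cond₂ n hn m hm m hm le_rfl _ h1).trans ?_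
  have := S.nonneg₂
  have := S.rate_nonneg m
  gcongr
  linarith

/-- The second mixing condition for an increment of `A` across the observables at distance `k`. -/
theorem integral_increment_le (S : IsMixing μ T g N M ρ C₂ C₃) (hA : IsLipMatrix A KA K)
    {n m k : ℕ} (hn : n < N) (hk : k < N) (hmk : m ≤ k) {u : ℝ} (hu : u ∈ Set.Icc (0 : ℝ) 1) :
    |∫ x, bilin (fbar μ T g n x)
      (A (outer μ T g N n (k + 1) x + u • fbarAt μ T g N n k x) - A (outer μ T g N n (k + 1) x))
      (fbarAt μ T g N n m x) ∂μ| ≤ C₂ * (7 * M * K) * ρ m := by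
  have hM := S.one_le
  have hK := hA.lip_nonneg
  obtain ⟨h1, h2, h3⟩ := isTest_increment (r := 4 * M + 1) hA.contDiff hA.norm_fderiv_le
    (by linarith) hu.1 hu.2
  simp_rw [outer_succ]
  refine (S.cond₂ n hn m (hmk.trans_lt hk) k hk hmk _ h1).trans ?_
  have := S.nonneg₂
  have := S.rate_nonneg m
  gcongr
  -- `K (4M + 1) + 2K ≤ 7MK`, as `M ≥ 1`
  nlinarith

variable [IsProbabilityMeasure μ]

/-- The difference between two consecutive approximations of `A (total)` obtained by
removing the observables at distance `k` from `n`. -/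
theorem norm_outer_sub_le (S : IsMixing μ T g N M ρ C₂ C₃) (hA : IsLipMatrix A KA K)
    (n k : ℕ) (x : X) :
    ‖A (outer μ T g N n k x) - A (outer μ T g N n (k + 1) x)‖ ≤ 4 * M * K := by
  have hK := hA.lip_nonneg
  refine (hA.norm_sub_le _ _).trans ?_
  rw [outer_eq_add n k, add_sub_cancel_left]
  nlinarith [norm_fbarAt_le (μ := μ) (T := T) (zero_le_one.trans S.one_le) S.norm_le n k x]

/-- For indices far outside of the window the centred increment decouples by the third mixing
condition. -/
theorem integral_centred_far_le (S : IsMixing μ T g N M ρ C₂ C₃) (hA : IsLipMatrix A KA K)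
    {n m k : ℕ} (hn : n < N) (hk : k < N) (hmk : 2 * m ≤ k) :
    |∫ x, bilin (fbar μ T g n x)
      (A (outer μ T g N n k x) - A (outer μ T g N n (k + 1) x)
        - ∫ y, (A (outer μ T g N n k y) - A (outer μ T g N n (k + 1) y)) ∂μ)
      (fbarAt μ T g N n m x) ∂μ| ≤ C₃ * (7 * M * K) * ρ (k - m) := by
  have hM := S.one_le
  have hK := hA.lip_nonneg
  obtain ⟨h1, h2, h3⟩ := isTest_increment (r := 4 * M + 1) hA.contDiff hA.norm_fderiv_le
    (by linarith) zero_le_one le_rfl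
  have h := S.cond₃ n hn m (by omega) k hk hmk _ h1
  have hi : Integrable (fun y => A (outer μ T g N n k y) - A (outer μ T g N n (k + 1) y)) μ :=
    (hA.integrable_comp (measurable_outer S.measurable_map S.measurable_obs N n k)).sub
      (hA.integrable_comp (measurable_outer S.measurable_map S.measurable_obs N n (k + 1)))
  rw [← of_integral hi]
  simp_rw [outer_eq_add_smul n k, outer_succ]
  refine h.trans ?_
  have := S.nonneg₃
  have := S.rate_nonneg (k - m)
  gcongr
  nlinarith

/-- For indices close to the window, the second mixing condition is applied to the increment and
to its mean separately. -/
theorem integral_centred_near_le (S : IsMixing μ T g N M ρ C₂ C₃) (hA : IsLipMatrix A KA K)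
    {n m k : ℕ} (hn : n < N) (hk : k < N) (hmk : m ≤ k) :
    |∫ x, bilin (fbar μ T g n x)
      (A (outer μ T g N n k x) - A (outer μ T g N n (k + 1) x)
        - ∫ y, (A (outer μ T g N n k y) - A (outer μ T g N n (k + 1) y)) ∂μ)
      (fbarAt μ T g N n m x) ∂μ| ≤ C₂ * (14 * M * K) * ρ m := by
  have hM := S.one_le
  have hK := hA.lip_nonneg
  have h1 := integral_increment_le S hA hn hk hmk (u := 1) ⟨zero_le_one, le_rfl⟩
  simp_rw [← outer_eq_add_smul n k] at h1
  set D := ∫ y, (A (outer μ T g N n k y) - A (outer μ T g N n (k + 1) y)) ∂μ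
  have hD : ‖D‖ ≤ 4 * M * K := by
    have := norm_integral_le_of_norm_le_const (μ := μ)
      (ae_of_all _ fun y => norm_outer_sub_le S hA n k y)
    simpa using this
  have h2 := integral_const_le S hn (hmk.trans_lt hk) D
  simp_rw [bilin_sub_mat _ (A _ - A _) D]
  rw [integral_sub]
  · refine (abs_sub _ _).trans ((add_le_add h1 h2).trans ?_)
    have h3 : C₂ * ‖D‖ * ρ m ≤ C₂ * (7 * M * K) * ρ m := by
      have := S.nonneg₂
      have := S.rate_nonneg m
      gcongr
      nlinarith
    linarith
  · exact integrable_bilin (measurable_fbar S.measurable_map S.measurable_obs n)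
      (measurable_fbarAt S.measurable_map S.measurable_obs N n m)
      ((hA.aestronglyMeasurable_comp (measurable_outer S.measurable_map S.measurable_obs N n k)).sub
        (hA.aestronglyMeasurable_comp
          (measurable_outer S.measurable_map S.measurable_obs N n (k + 1))))
      (norm_fbar_le S.norm_le hn) (norm_outer_sub_le S hA n k)
      (norm_fbarAt_le (by linarith) S.norm_le n m)
  · exact integrable_bilin (measurable_fbar S.measurable_map S.measurable_obs n)
      (measurable_fbarAt S.measurable_map S.measurable_obs N n m) aestronglyMeasurable_const
      (norm_fbar_le S.norm_le hn) (fun _ => le_rfl) (norm_fbarAt_le (by linarith) S.norm_le n m)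

/-- Taylor remainder: replacing the increment of `F` by its linearization outside of the
window. -/
theorem integral_taylor_le (S : IsMixing μ T g N M ρ C₂ C₃) (hA : IsLipMatrix A KA K)
    {F : Vec d → Vec d} (hF : ∀ x, HasFDerivAt F (Matrix.toEuclideanCLM (𝕜 := ℝ) (A x)) x)
    {KF : ℝ} (hFb : ∀ x, ‖F x‖ ≤ KF) {n m : ℕ} (hn : n < N) (hm : m < N) :
    |(∫ x, inner ℝ (fbar μ T g n x)
        (F (outer μ T g N n m x) - F (outer μ T g N n (m + 1) x)) ∂μ)
      - ∫ x, bilin (fbar μ T g n x) (A (outer μ T g N n (m + 1) x)) (fbarAt μ T g N n m x) ∂μ|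
      ≤ C₂ * (7 * M * K) * ρ m := by
  have hM := S.one_le
  have mf := measurable_fbar (μ := μ) S.measurable_map S.measurable_obs n
  have ma := measurable_fbarAt (μ := μ) S.measurable_map S.measurable_obs N n m
  have mo := measurable_outer (μ := μ) S.measurable_map S.measurable_obs N n (m + 1)
  have bf := norm_fbar_le (μ := μ) (T := T) S.norm_le hn
  have ba := norm_fbarAt_le (μ := μ) (T := T) (by linarith) S.norm_le n m
  have hFc : Continuous F := continuous_iff_continuousAt.2 fun x => (hF x).continuousAt
  set f := fbar μ T g n
  set a := fbarAt μ T g N n m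
  set V := outer μ T g N n (m + 1)
  have hKA : 0 ≤ KA := (norm_nonneg _).trans (hA.norm_le 0)
  have mV : ∀ u : ℝ, Measurable fun x => V x + u • a x := fun u => mo.add (ma.const_smul u)
  have iF : ∀ u : ℝ, Integrable (fun x => (inner ℝ (f x) (F (V x + u • a x)) : ℝ)) μ := fun u => by
    refine Integrable.of_bound (C := 2 * M * KF) (mf.aestronglyMeasurable.inner
      (hFc.comp_aestronglyMeasurable (mV u).aestronglyMeasurable)) (ae_of_all _ fun x => ?_)
    have := bf x
    have := hFb (V x + u • a x)
    exact (abs_real_inner_le_norm _ _).trans (by gcongr)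
  have iA : ∀ u : ℝ, Integrable (fun x => bilin (f x) (A (V x + u • a x)) (a x)) μ := fun u =>
    integrable_bilin mf ma (hA.aestronglyMeasurable_comp (mV u)) bf (fun x => hA.norm_le _) ba
  have iA0 : Integrable (fun x => bilin (f x) (A (V x)) (a x)) μ := by simpa using iA 0
  have hder : ∀ u : ℝ, HasDerivAt (fun u => ∫ x, (inner ℝ (f x) (F (V x + u • a x)) : ℝ) ∂μ)
      (∫ x, bilin (f x) (A (V x + u • a x)) (a x) ∂μ) u := by
    intro u
    refine (hasDerivAt_integral_of_dominated_loc_of_deriv_le (μ := μ) (s := Set.univ)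
      (F' := fun u x => bilin (f x) (A (V x + u • a x)) (a x))
      (bound := fun _ => 2 * M * (KA * (4 * M))) univ_mem
      (Eventually.of_forall fun u => (iF u).aestronglyMeasurable) (iF u)
      (iA u).aestronglyMeasurable (ae_of_all _ fun x u _ => ?_) (integrable_const _)
      (ae_of_all _ fun x u _ => ?_)).2
    · have := hA.norm_le (V x + u • a x)
      have := bf x
      have := ba x
      exact (abs_bilin_le _ _ _).trans (by gcongr)
    · have h1 : HasDerivAt (fun u : ℝ => V x + u • a x) (a x) u := by
        simpa using ((hasDerivAt_id u).smul_const (a x)).const_add (V x)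
      have h2 := (hF (V x + u • a x)).comp_hasDerivAt u h1
      have h3 := (hasDerivAt_const u (f x)).inner ℝ h2
      simp only [inner_zero_left, add_zero] at h3
      rw [bilin_eq_inner]
      exact h3
  set c := ∫ x, bilin (f x) (A (V x)) (a x) ∂μ
  -- The mean value inequality along `u ↦ E⟪f, F(V + u a)⟫` replaces the integral remainder, so that
  -- the mixing condition is applied for each fixed `u`.
  have key := Convex.norm_image_sub_le_of_norm_hasDerivWithin_le (s := Set.Icc (0 : ℝ) 1)
    (f := fun u => (∫ x, (inner ℝ (f x) (F (V x + u • a x)) : ℝ) ∂μ) - u * c)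
    (f' := fun u => (∫ x, bilin (f x) (A (V x + u • a x)) (a x) ∂μ) - c)
    (C := C₂ * (7 * M * K) * ρ m)
    (fun u _ => by
      have := (hder u).sub ((hasDerivAt_id u).mul_const c)
      rw [one_mul] at this
      exact this.hasDerivWithinAt)
    (fun u hu => by
      have := integral_increment_le S hA hn hm le_rfl hu
      simp_rw [bilin_sub_mat] at this
      rw [integral_sub (iA u) iA0] at this
      exact this)
    (convex_Icc 0 1) (Set.left_mem_Icc.2 zero_le_one) (Set.right_mem_Icc.2 zero_le_one)
  have e : ∀ x, outer μ T g N n m x = V x + a x := fun x => outer_eq_add n m x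
  simp_rw [e, inner_sub_right]
  have i1 := iF 1
  have i0 := iF 0
  simp only [one_smul, zero_smul, add_zero] at i1 i0
  rw [integral_sub i1 i0]
  simp only [one_smul, zero_smul, add_zero, one_mul, zero_mul, sub_zero, norm_one, mul_one,
    Real.norm_eq_abs] at key
  convert key using 2
  ring

theorem norm_integral_outer_sub_le (S : IsMixing μ T g N M ρ C₂ C₃) (hA : IsLipMatrix A KA K)
    (n m : ℕ) :
    ‖(∫ x, A (outer μ T g N n m x) ∂μ) - ∫ x, A (total μ T g N x) ∂μ‖ ≤ 4 * M * K * m := by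
  have mo := measurable_outer (μ := μ) S.measurable_map S.measurable_obs N n
  have mt := measurable_total (μ := μ) S.measurable_map S.measurable_obs N
  rw [← integral_sub (hA.integrable_comp (mo m)) (hA.integrable_comp mt)]
  have : ∀ x, ‖A (outer μ T g N n m x) - A (total μ T g N x)‖ ≤ 4 * M * K * m := fun x => by
    rw [← outer_zero n, norm_sub_rev, ← Finset.sum_range_sub' (fun k => A (outer μ T g N n k x))]
    refine (norm_sum_le_of_le _ fun k _ => norm_outer_sub_le S hA n k x).trans ?_
    simp [mul_comm]
  simpa using norm_integral_le_of_norm_le_const (μ := μ) (ae_of_all _ this)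

/-- Decoupling of the linearized term: outside of the window the matrix may be replaced by its
mean. The centred matrix is a telescoping sum of centred increments, of which the `m` closest
ones and the remaining ones are controlled by different mixing conditions. -/
theorem integral_centred_le (S : IsMixing μ T g N M ρ C₂ C₃) (hA : IsLipMatrix A KA K)
    {n m : ℕ} (hn : n < N) (hm : m < N) :
    |∫ x, bilin (fbar μ T g n x) (A (outer μ T g N n (m + 1) x) - ∫ y, A (total μ T g N y) ∂μ)
        (fbarAt μ T g N n m x) ∂μ|
      ≤ (∑ i ∈ Finset.range (N - 1), if i + 1 ≤ m then C₂ * (14 * M * K) * ρ m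
          else C₃ * (7 * M * K) * ρ (i + 1)) + C₂ * (4 * M * K * (m + 1 : ℕ)) * ρ m := by
  have hM := S.one_le
  have hK := hA.lip_nonneg
  have hC₂ := S.nonneg₂
  have hC₃ := S.nonneg₃
  have hρ := S.rate_nonneg
  have mf := measurable_fbar (μ := μ) S.measurable_map S.measurable_obs n
  have ma := measurable_fbarAt (μ := μ) S.measurable_map S.measurable_obs N n m
  have mo := measurable_outer (μ := μ) S.measurable_map S.measurable_obs N n
  have bf := norm_fbar_le (μ := μ) (T := T) S.norm_le hn
  have ba := norm_fbarAt_le (μ := μ) (T := T) (by linarith) S.norm_le n m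
  set E₀ := ∫ y, A (total μ T g N y) ∂μ with hE₀
  set D : ℕ → X → Matrix (Fin d) (Fin d) ℝ := fun k x =>
    A (outer μ T g N n k x) - A (outer μ T g N n (k + 1) x) with hD
  have iD : ∀ k, Integrable (D k) μ := fun k =>
    (hA.integrable_comp (mo k)).sub (hA.integrable_comp (mo (k + 1)))
  have tele : ∀ x, ∑ i ∈ Finset.range (N - (m + 1)), D (m + 1 + i) x
      = A (outer μ T g N n (m + 1) x) - A 0 := fun x => by
    have := Finset.sum_range_sub' (fun i => A (outer μ T g N n (m + 1 + i) x)) (N - (m + 1))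
    simp only [add_zero, Nat.add_sub_cancel' (show m + 1 ≤ N from hm), outer_self hn] at this
    exact this
  have teleI : ∑ i ∈ Finset.range (N - (m + 1)), ∫ x, D (m + 1 + i) x ∂μ
      = (∫ x, A (outer μ T g N n (m + 1) x) ∂μ) - A 0 := by
    rw [← integral_finsetSum _ fun i _ => iD _]
    simp_rw [tele]
    rw [integral_sub (hA.integrable_comp (mo _)) (integrable_const _)]
    simp
  have split : ∀ x, bilin (fbar μ T g n x) (A (outer μ T g N n (m + 1) x) - E₀)
        (fbarAt μ T g N n m x)
      = (∑ i ∈ Finset.range (N - (m + 1)), bilin (fbar μ T g n x)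
          (D (m + 1 + i) x - ∫ y, D (m + 1 + i) y ∂μ) (fbarAt μ T g N n m x))
        - bilin (fbar μ T g n x) (E₀ - ∫ y, A (outer μ T g N n (m + 1) y) ∂μ)
          (fbarAt μ T g N n m x) := fun x => by
    rw [← bilin_sum_mat, Finset.sum_sub_distrib, tele, teleI, ← bilin_sub_mat]
    congr 1
    abel
  have i1 : ∀ k, Integrable (fun x => bilin (fbar μ T g n x)
      (D k x - ∫ y, D k y ∂μ) (fbarAt μ T g N n m x)) μ := fun k =>
    integrable_bilin mf ma ((iD k).aestronglyMeasurable.sub aestronglyMeasurable_const) bf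
      (b := 4 * M * K + ‖∫ y, D k y ∂μ‖)
      (fun x => (norm_sub_le _ _).trans (by gcongr; exact norm_outer_sub_le S hA n k x)) ba
  have i2 : Integrable (fun x => bilin (fbar μ T g n x)
      (E₀ - ∫ y, A (outer μ T g N n (m + 1) y) ∂μ) (fbarAt μ T g N n m x)) μ :=
    integrable_bilin mf ma aestronglyMeasurable_const bf (fun _ => le_rfl) ba
  simp_rw [split]
  rw [integral_sub (integrable_finsetSum _ fun i _ => i1 _) i2,
    integral_finsetSum _ fun i _ => i1 _]
  refine (abs_sub _ _).trans (add_le_add ?_ ?_)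
  · refine (Finset.abs_sum_le_sum_abs _ _).trans ?_
    refine (Finset.sum_le_sum (g := fun i => if i + 1 ≤ m then C₂ * (14 * M * K) * ρ m
          else C₃ * (7 * M * K) * ρ (i + 1)) fun i hi => ?_).trans
      (Finset.sum_le_sum_of_subset_of_nonneg
        (Finset.range_subset_range.2 (by omega)) fun i _ _ => ?_)
    · have hi' : m + 1 + i < N := by have := Finset.mem_range.1 hi; omega
      split_ifs with h
      · exact integral_centred_near_le S hA hn hi' (by omega)
      · have := integral_centred_far_le S hA hn hi' (m := m) (by omega)
        rwa [show m + 1 + i - m = i + 1 by omega] at this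
    · have := hρ m
      have := hρ (i + 1)
      split_ifs <;> positivity
  · refine (integral_const_le S hn hm _).trans ?_
    have := hρ m
    gcongr
    rw [norm_sub_rev]
    exact norm_integral_outer_sub_le S hA n (m + 1)

/-- Summing over the distance `m` the bounds for a fixed index `n`. Each rate `ρ(j)` with `j ≥ 1` is
counted at most a constant multiple of `j` times. -/
theorem sum_bound_le (hρ : ∀ n, 0 ≤ ρ n) (hC₂ : 0 ≤ C₂) (hC₃ : 0 ≤ C₃) {Q R : ℝ} (hQ : 0 ≤ Q)
    (hR1 : 1 ≤ R) (hR : ∑ m ∈ Finset.Ico 1 N, m * ρ m ≤ R) (hN : 1 ≤ N) :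
    ∑ m ∈ Finset.range N, (C₂ * (7 * Q) * ρ m
      + ((∑ i ∈ Finset.range (N - 1), if i + 1 ≤ m then C₂ * (14 * Q) * ρ m
          else C₃ * (7 * Q) * ρ (i + 1)) + C₂ * (4 * Q * (m + 1 : ℕ)) * ρ m))
      ≤ 31 * (C₂ + C₃) * Q * (1 + ρ 0) * R := by
  have hS : ∑ i ∈ Finset.range (N - 1), ((i + 1 : ℕ) : ℝ) * ρ (i + 1) ≤ R := by
    rw [Finset.sum_Ico_eq_sum_range] at hR
    simpa [add_comm] using hR
  set S := ∑ i ∈ Finset.range (N - 1), ((i + 1 : ℕ) : ℝ) * ρ (i + 1)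
  have hS0 : 0 ≤ S := Finset.sum_nonneg fun i _ => mul_nonneg (Nat.cast_nonneg _) (hρ _)
  -- At most `m` increments are close to the window of radius `m`.
  have near : ∀ m : ℕ, (∑ i ∈ Finset.range (N - 1), if i + 1 ≤ m then C₂ * (14 * Q) * ρ m else 0)
      ≤ m * (C₂ * (14 * Q) * ρ m) := fun m => by
    rw [← Finset.sum_filter, Finset.sum_const, nsmul_eq_mul]
    have hc : ((Finset.range (N - 1)).filter (fun i => i + 1 ≤ m)).card ≤ m := by
      refine (Finset.card_le_card (t := Finset.range m) fun i hi => ?_).trans (by simp)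
      simp only [Finset.mem_filter, Finset.mem_range] at hi ⊢
      omega
    have := hρ m
    gcongr
  -- The rate `ρ(i + 1)` arises from the windows of radius `m ≤ i` only.
  have far : ∑ m ∈ Finset.range N, (∑ i ∈ Finset.range (N - 1),
      if i + 1 ≤ m then 0 else C₃ * (7 * Q) * ρ (i + 1)) ≤ C₃ * (7 * Q) * S := by
    rw [Finset.sum_comm, Finset.mul_sum]
    refine Finset.sum_le_sum fun i _ => ?_
    simp_rw [← ite_not (p := i + 1 ≤ _)]
    rw [← Finset.sum_filter, Finset.sum_const, nsmul_eq_mul]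
    have hc : ((Finset.range N).filter (fun m => ¬ i + 1 ≤ m)).card ≤ i + 1 := by
      refine (Finset.card_le_card (t := Finset.range (i + 1)) fun m hm => ?_).trans (by simp)
      simp only [Finset.mem_filter, Finset.mem_range] at hm ⊢
      omega
    have := hρ (i + 1)
    calc _ ≤ ((i + 1 : ℕ) : ℝ) * (C₃ * (7 * Q) * ρ (i + 1)) := by gcongr
      _ = _ := by ring
  have rest : ∑ m ∈ Finset.range N, (C₂ * (7 * Q) * ρ m + (m * (C₂ * (14 * Q) * ρ m)
      + C₂ * (4 * Q * (m + 1 : ℕ)) * ρ m)) ≤ C₂ * Q * (11 * ρ 0 + 29 * S) := by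
    obtain ⟨N, rfl⟩ : ∃ n, N = n + 1 := ⟨N - 1, by omega⟩
    rw [Finset.sum_range_succ']
    have h1 : ∑ m ∈ Finset.range N, (C₂ * (7 * Q) * ρ (m + 1)
        + ((m + 1 : ℕ) * (C₂ * (14 * Q) * ρ (m + 1))
        + C₂ * (4 * Q * (m + 1 + 1 : ℕ)) * ρ (m + 1)))
        ≤ ∑ m ∈ Finset.range N, C₂ * Q * 29 * (((m + 1 : ℕ) : ℝ) * ρ (m + 1)) := by
      refine Finset.sum_le_sum fun m _ => ?_
      have h2 : 0 ≤ C₂ * Q * ρ (m + 1) := by have := hρ (m + 1); positivity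
      push_cast
      nlinarith [mul_nonneg h2 (Nat.cast_nonneg (α := ℝ) m)]
    rw [← Finset.mul_sum] at h1
    push_cast at h1 ⊢
    have : S = ∑ i ∈ Finset.range N, ((i : ℝ) + 1) * ρ (i + 1) := by simp [S]
    rw [← this] at h1
    linarith
  have split : ∀ m : ℕ, (∑ i ∈ Finset.range (N - 1), if i + 1 ≤ m then C₂ * (14 * Q) * ρ m
      else C₃ * (7 * Q) * ρ (i + 1))
      = (∑ i ∈ Finset.range (N - 1), if i + 1 ≤ m then C₂ * (14 * Q) * ρ m else 0)
        + ∑ i ∈ Finset.range (N - 1), if i + 1 ≤ m then 0 else C₃ * (7 * Q) * ρ (i + 1) :=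
    fun m => by
      rw [← Finset.sum_add_distrib]
      refine Finset.sum_congr rfl fun i _ => ?_
      split_ifs <;> simp
  calc _ ≤ ∑ m ∈ Finset.range N, ((C₂ * (7 * Q) * ρ m + (m * (C₂ * (14 * Q) * ρ m)
      + C₂ * (4 * Q * (m + 1 : ℕ)) * ρ m)) + ∑ i ∈ Finset.range (N - 1),
        if i + 1 ≤ m then 0 else C₃ * (7 * Q) * ρ (i + 1)) := by
        refine Finset.sum_le_sum fun m _ => ?_
        rw [split m]
        linarith [near m]
    _ ≤ C₂ * Q * (11 * ρ 0 + 29 * S) + C₃ * (7 * Q) * S := by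
        rw [Finset.sum_add_distrib]
        exact add_le_add rest far
    _ ≤ C₂ * Q * (31 * ((1 + ρ 0) * R)) + C₃ * Q * (31 * ((1 + ρ 0) * R)) := by
        have h0 := hρ 0
        have h1 : S ≤ (1 + ρ 0) * R := by nlinarith
        have h2 : 11 * ρ 0 + 29 * S ≤ 31 * ((1 + ρ 0) * R) := by nlinarith
        have h3 : 7 * S ≤ 31 * ((1 + ρ 0) * R) := by nlinarith
        have h4 : C₃ * (7 * Q) * S = C₃ * Q * (7 * S) := by ring
        rw [h4]
        gcongr
    _ = _ := by ring

/-- The Stein-type bound: for a bounded map `F` with Lipschitz Jacobian `A`, the sum `S` of the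
centred observables satisfies `E⟪S, F S⟫ ≈ E[Sᵀ (E A(S)) S]`. -/
theorem stein_bound (S : IsMixing μ T g N M ρ C₂ C₃) (hA : IsLipMatrix A KA K)
    {F : Vec d → Vec d} (hF : ∀ x, HasFDerivAt F (Matrix.toEuclideanCLM (𝕜 := ℝ) (A x)) x)
    {KF : ℝ} (hFb : ∀ x, ‖F x‖ ≤ KF) (hN : 1 ≤ N) {R : ℝ} (hR1 : 1 ≤ R)
    (hR : ∑ m ∈ Finset.Ico 1 N, m * ρ m ≤ R) :
    |(∫ x, inner ℝ (total μ T g N x) (F (total μ T g N x)) ∂μ)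
      - ∫ x, bilin (total μ T g N x) (∫ y, A (total μ T g N y) ∂μ) (total μ T g N x) ∂μ|
      ≤ N * (31 * (C₂ + C₃) * (M * K) * (1 + ρ 0) * R) := by
  have hM := S.one_le
  have mf := measurable_fbar (μ := μ) S.measurable_map S.measurable_obs
  have ma := measurable_fbarAt (μ := μ) S.measurable_map S.measurable_obs N
  have mo := measurable_outer (μ := μ) S.measurable_map S.measurable_obs N
  have bf := fun n (hn : n < N) => norm_fbar_le (μ := μ) (T := T) S.norm_le hn
  have ba := norm_fbarAt_le (μ := μ) (T := T) (by linarith) S.norm_le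
  have hFc : Continuous F := continuous_iff_continuousAt.2 fun x => (hF x).continuousAt
  set E₀ := ∫ y, A (total μ T g N y) ∂μ with hE₀
  have iF : ∀ n < N, ∀ m, Integrable
      (fun x => (inner ℝ (fbar μ T g n x) (F (outer μ T g N n m x)) : ℝ)) μ := fun n hn m => by
    refine Integrable.of_bound (C := 2 * M * KF) ((mf n).aestronglyMeasurable.inner
      (hFc.comp_aestronglyMeasurable (mo n m).aestronglyMeasurable)) (ae_of_all _ fun x => ?_)
    have := bf n hn x
    have := hFb (outer μ T g N n m x)
    exact (abs_real_inner_le_norm _ _).trans (by gcongr)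
  have iB : ∀ n < N, ∀ m, Integrable
      (fun x => bilin (fbar μ T g n x) E₀ (fbarAt μ T g N n m x)) μ := fun n hn m =>
    integrable_bilin (mf n) (ma n m) aestronglyMeasurable_const (bf n hn) (fun _ => le_rfl) (ba n m)
  have iA : ∀ n < N, ∀ m, Integrable (fun x => bilin (fbar μ T g n x)
      (A (outer μ T g N n (m + 1) x)) (fbarAt μ T g N n m x)) μ := fun n hn m =>
    integrable_bilin (mf n) (ma n m) (hA.aestronglyMeasurable_comp (mo n _)) (bf n hn)
      (fun _ => hA.norm_le _) (ba n m)
  have zero : ∀ n < N, ∫ x, (inner ℝ (fbar μ T g n x) (F 0) : ℝ) ∂μ = 0 := fun n hn => by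
    have i : Integrable (fbar μ T g n) μ :=
      Integrable.of_bound (mf n).aestronglyMeasurable _ (ae_of_all _ (bf n hn))
    simp_rw [real_inner_comm (F 0)]
    rw [integral_inner i, integral_fbar S.measurable_map S.measurable_obs S.norm_le hn,
      inner_zero_right]
  have e1 : ∫ x, (inner ℝ (total μ T g N x) (F (total μ T g N x)) : ℝ) ∂μ
      = ∑ n ∈ Finset.range N, ∑ m ∈ Finset.range N, ∫ x, (inner ℝ (fbar μ T g n x)
        (F (outer μ T g N n m x) - F (outer μ T g N n (m + 1) x)) : ℝ) ∂μ := by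
    have : ∀ x, (inner ℝ (total μ T g N x) (F (total μ T g N x)) : ℝ)
        = ∑ n ∈ Finset.range N, inner ℝ (fbar μ T g n x) (F (outer μ T g N n 0 x)) := fun x => by
      simp_rw [outer_zero]
      rw [← sum_inner]
      rfl
    simp_rw [this]
    rw [integral_finsetSum _ fun n hn => iF n (Finset.mem_range.1 hn) 0]
    refine Finset.sum_congr rfl fun n hn => ?_
    have hn := Finset.mem_range.1 hn
    simp_rw [inner_sub_right]
    simp_rw [integral_sub (iF n hn _) (iF n hn _)]
    rw [Finset.sum_range_sub' (fun m => ∫ x, (inner ℝ (fbar μ T g n x)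
      (F (outer μ T g N n m x)) : ℝ) ∂μ)]
    simp_rw [outer_self hn]
    rw [zero n hn, sub_zero]
  have e2 : ∫ x, bilin (total μ T g N x) E₀ (total μ T g N x) ∂μ
      = ∑ n ∈ Finset.range N, ∑ m ∈ Finset.range N, ∫ x,
        bilin (fbar μ T g n x) E₀ (fbarAt μ T g N n m x) ∂μ := by
    have : ∀ x, bilin (total μ T g N x) E₀ (total μ T g N x)
        = ∑ n ∈ Finset.range N, ∑ m ∈ Finset.range N,
          bilin (fbar μ T g n x) E₀ (fbarAt μ T g N n m x) := fun x => by
      calc _ = ∑ n ∈ Finset.range N, bilin (fbar μ T g n x) E₀ (total μ T g N x) := by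
            rw [← bilin_sum_left]; rfl
        _ = _ := Finset.sum_congr rfl fun n hn => by
            rw [total_eq_sum_fbarAt (Finset.mem_range.1 hn), bilin_sum_right]
    simp_rw [this]
    rw [integral_finsetSum _ fun n hn => integrable_finsetSum _ fun m _ =>
      iB n (Finset.mem_range.1 hn) m]
    exact Finset.sum_congr rfl fun n hn =>
      integral_finsetSum _ fun m _ => iB n (Finset.mem_range.1 hn) m
  rw [e1, e2, ← Finset.sum_sub_distrib]
  refine (Finset.abs_sum_le_sum_abs _ _).trans ?_
  rw [← Finset.card_range N, ← nsmul_eq_mul, Finset.card_range N]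
  refine (Finset.sum_le_card_nsmul _ _ _ fun n hn => ?_).trans_eq (by rw [Finset.card_range])
  have hn := Finset.mem_range.1 hn
  rw [← Finset.sum_sub_distrib]
  refine (Finset.abs_sum_le_sum_abs _ _).trans (le_trans (Finset.sum_le_sum fun m hm => ?_)
    (sum_bound_le S.rate_nonneg S.nonneg₂ S.nonneg₃ (by
      have := hA.lip_nonneg; positivity) hR1 hR hN))
  have hm := Finset.mem_range.1 hm
  have b1 := integral_taylor_le S hA hF hFb hn hm
  have b2 := integral_centred_le S hA hn hm
  simp_rw [bilin_sub_mat] at b2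
  rw [integral_sub (iA n hn m) (iB n hn m)] at b2
  simp only [← mul_assoc] at b1 b2 ⊢
  refine (abs_sub_le _ _ _).trans (add_le_add b1 b2)

end IsMixing

/-! ### The covariance matrix and the self-normalizing matrix -/

section Covariance

variable {X : Type*} [MeasurableSpace X] {d : ℕ} {μ : Measure X} [IsProbabilityMeasure μ]
  {T : ℕ → X → X} {g : ℕ → X → Vec d} {N : ℕ} {M : ℝ} {ρ : ℕ → ℝ} {C₂ C₃ : ℝ}

theorem abs_total_apply_le (hgM : ∀ i < N, ∀ x, ‖g i x‖ ≤ M) (x : X) (α : Fin d) :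
    |total μ T g N x α| ≤ 2 * M * N :=
  (PiLp.norm_apply_le _ α).trans (norm_total_le hgM x)

namespace IsMixing

theorem integral_total_apply (S : IsMixing μ T g N M ρ C₂ C₃) (α : Fin d) :
    ∫ x, total μ T g N x α ∂μ = 0 := by
  have hi : ∀ i ∈ Finset.range N, Integrable (fbar μ T g i) μ := fun i hi =>
    Integrable.of_bound (measurable_fbar S.measurable_map S.measurable_obs i).aestronglyMeasurable
      _ (ae_of_all _ (norm_fbar_le S.norm_le (Finset.mem_range.1 hi)))
  have h : ∫ x, total μ T g N x ∂μ = 0 := by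
    unfold total
    rw [integral_finsetSum _ hi]
    exact Finset.sum_eq_zero fun i hi =>
      integral_fbar S.measurable_map S.measurable_obs S.norm_le (Finset.mem_range.1 hi)
  have := (EuclideanSpace.proj α : Vec d →L[ℝ] ℝ).integral_comp_comm
    (integrable_finsetSum _ hi : Integrable (fun x => ∑ i ∈ Finset.range N, fbar μ T g i x) μ)
  change ∫ x, (EuclideanSpace.proj α : Vec d →L[ℝ] ℝ) (total μ T g N x) ∂μ
    = (EuclideanSpace.proj α : Vec d →L[ℝ] ℝ) (∫ x, total μ T g N x ∂μ) at this
  rw [h] at this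
  simpa using this

omit [IsProbabilityMeasure μ] in
theorem measurable_total_apply (S : IsMixing μ T g N M ρ C₂ C₃) (α : Fin d) :
    Measurable fun x => total μ T g N x α :=
  (EuclideanSpace.proj α : Vec d →L[ℝ] ℝ).continuous.measurable.comp
    (measurable_total S.measurable_map S.measurable_obs N)

theorem covMat_apply (S : IsMixing μ T g N M ρ C₂ C₃) (α β : Fin d) :
    covMat μ T g N α β = ∫ x, total μ T g N x α * total μ T g N x β ∂μ := by
  have h2 : ∀ α, MemLp (fun x => total μ T g N x α) 2 μ := fun α =>
    MemLp.of_bound (S.measurable_total_apply α).aestronglyMeasurable _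
      (ae_of_all _ fun x => abs_total_apply_le S.norm_le x α)
  simp only [covMat, Matrix.of_apply]
  rw [covariance_eq_sub (h2 α) (h2 β), S.integral_total_apply, zero_mul, sub_zero]
  rfl

theorem integrable_total_mul (S : IsMixing μ T g N M ρ C₂ C₃) (α β : Fin d) :
    Integrable (fun x => total μ T g N x α * total μ T g N x β) μ := by
  refine Integrable.of_bound (C := (2 * M * N) * (2 * M * N))
    ((S.measurable_total_apply α).mul (S.measurable_total_apply β)).aestronglyMeasurable
    (ae_of_all _ fun x => ?_)
  have h := abs_total_apply_le (μ := μ) (T := T) S.norm_le x α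
  have h' := abs_total_apply_le (μ := μ) (T := T) S.norm_le x β
  rw [norm_mul]
  exact mul_le_mul h h' (abs_nonneg _) ((abs_nonneg _).trans h)

/-- Quadratic forms in the sum of the centred observables have the expectation determined by the
covariance matrix. -/
theorem integral_bilin_total (S : IsMixing μ T g N M ρ C₂ C₃) (B : Matrix (Fin d) (Fin d) ℝ) :
    ∫ x, bilin (total μ T g N x) B (total μ T g N x) ∂μ = (B * covMat μ T g N).trace := by
  have : ∀ x, bilin (total μ T g N x) B (total μ T g N x)
      = ∑ i, ∑ j, B i j * (total μ T g N x j * total μ T g N x i) := fun x => by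
    simp only [bilin, dotProduct, Matrix.mulVec, Finset.mul_sum]
    exact Finset.sum_congr rfl fun i _ => Finset.sum_congr rfl fun j _ => by ring
  simp_rw [this]
  have hi : ∀ i j, Integrable
      (fun x => B i j * (total μ T g N x j * total μ T g N x i)) μ := fun i j =>
    (S.integrable_total_mul j i).const_mul _
  rw [integral_finsetSum (f := fun i x => ∑ j, B i j * (total μ T g N x j * total μ T g N x i))
    _ fun i _ => integrable_finsetSum _ fun j _ => hi i j]
  simp only [Matrix.trace, Matrix.diag, Matrix.mul_apply, S.covMat_apply]
  refine Finset.sum_congr rfl fun i _ => ?_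
  rw [integral_finsetSum _ fun j _ => hi i j]
  exact Finset.sum_congr rfl fun j _ => integral_const_mul _ _

theorem isHermitian_covMat (S : IsMixing μ T g N M ρ C₂ C₃) : (covMat μ T g N).IsHermitian := by
  ext α β
  simp only [Matrix.conjTranspose_apply, star_trivial, S.covMat_apply, mul_comm]

theorem algebraMap_lambdaMin_le (S : IsMixing μ T g N M ρ C₂ C₃) :
    algebraMap ℝ _ (lambdaMin μ T g N) ≤ covMat μ T g N := by
  have hsa : IsSelfAdjoint (covMat μ T g N) := S.isHermitian_covMat
  rw [algebraMap_le_iff_le_spectrum]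
  intro x hx
  exact csInf_le Matrix.finite_real_spectrum.bddBelow hx

theorem lambdaMin_mul_sq_le (S : IsMixing μ T g N M ρ C₂ C₃) (v : Vec d) :
    lambdaMin μ T g N * ‖v‖ ^ 2 ≤ bilin v (covMat μ T g N) v := by
  have h := (Matrix.le_iff.1 S.algebraMap_lambdaMin_le).dotProduct_mulVec_nonneg v.ofLp
  have h2 : (algebraMap ℝ (Matrix (Fin d) (Fin d) ℝ) (lambdaMin μ T g N)).mulVec v.ofLp
      = lambdaMin μ T g N • v.ofLp := by
    rw [Algebra.algebraMap_eq_smul_one, Matrix.smul_mulVec, Matrix.one_mulVec]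
  rw [Matrix.sub_mulVec, dotProduct_sub, h2, dotProduct_smul, star_trivial] at h
  have h3 : v.ofLp ⬝ᵥ v.ofLp = ‖v‖ ^ 2 := by
    rw [EuclideanSpace.real_norm_sq_eq]
    simp [dotProduct, sq]
  rw [h3, smul_eq_mul] at h
  simp only [bilin]
  linarith

theorem lambdaMin_le_sq (S : IsMixing μ T g N M ρ C₂ C₃) (hd : 1 ≤ d) :
    lambdaMin μ T g N ≤ (2 * M * N) ^ 2 := by
  have h := S.lambdaMin_mul_sq_le (EuclideanSpace.single ⟨0, hd⟩ 1)
  have h1 : bilin (EuclideanSpace.single (⟨0, hd⟩ : Fin d) 1) (covMat μ T g N)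
      (EuclideanSpace.single (⟨0, hd⟩ : Fin d) 1) = covMat μ T g N ⟨0, hd⟩ ⟨0, hd⟩ := by
    simp [bilin]
  rw [h1, S.covMat_apply] at h
  simp only [PiLp.norm_single, norm_one, one_pow, mul_one] at h
  refine h.trans ?_
  refine (integral_mono (S.integrable_total_mul _ _)
    (integrable_const ((2 * M * N) ^ 2)) fun x => ?_).trans (by simp)
  rw [← sq]
  exact sq_le_sq' (abs_le.1 (abs_total_apply_le S.norm_le x _)).1
    (abs_le.1 (abs_total_apply_le S.norm_le x _)).2

theorem covMat_nonneg (S : IsMixing μ T g N M ρ C₂ C₃) (hlam : 0 < lambdaMin μ T g N) :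
    0 ≤ covMat μ T g N := by
  refine Matrix.nonneg_iff_posSemidef.2
    (Matrix.PosSemidef.of_dotProduct_mulVec_nonneg S.isHermitian_covMat fun v => ?_)
  have := S.lambdaMin_mul_sq_le (WithLp.toLp 2 v)
  rw [star_trivial]
  exact (by positivity : (0 : ℝ) ≤ _).trans this

theorem bMat_mul_self (S : IsMixing μ T g N M ρ C₂ C₃) (hlam : 0 < lambdaMin μ T g N) :
    bMat μ T g N * bMat μ T g N = covMat μ T g N :=
  CFC.sqrt_mul_sqrt_self _ (S.covMat_nonneg hlam)

omit [IsProbabilityMeasure μ] in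
theorem transpose_bMat : (bMat μ T g N).transpose = bMat μ T g N := by
  have := (Matrix.nonneg_iff_posSemidef.1 (CFC.sqrt_nonneg (covMat μ T g N))).isHermitian
  simpa [bMat, Matrix.IsHermitian, Matrix.conjTranspose_eq_transpose_of_trivial] using this

theorem norm_mulVec_bMat_sq (S : IsMixing μ T g N M ρ C₂ C₃) (hlam : 0 < lambdaMin μ T g N)
    (v : Vec d) : ‖mulVec (bMat μ T g N) v‖ ^ 2 = bilin v (covMat μ T g N) v := by
  rw [← S.bMat_mul_self hlam, EuclideanSpace.real_norm_sq_eq]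
  simp only [bilin, mulVec]
  rw [← Matrix.mulVec_mulVec, Matrix.dotProduct_mulVec, ← Matrix.mulVec_transpose,
    transpose_bMat]
  simp [dotProduct, sq]

theorem isUnit_bMat (S : IsMixing μ T g N M ρ C₂ C₃) (hlam : 0 < lambdaMin μ T g N) :
    IsUnit (bMat μ T g N).det := by
  rw [isUnit_iff_ne_zero]
  intro h0
  obtain ⟨v, hv, hv0⟩ := Matrix.exists_mulVec_eq_zero_iff.2 h0
  have h1 := S.lambdaMin_mul_sq_le (WithLp.toLp 2 v)
  rw [← S.norm_mulVec_bMat_sq hlam] at h1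
  have h2 : mulVec (bMat μ T g N) (WithLp.toLp 2 v) = 0 := by simp [mulVec, hv0]
  rw [h2, norm_zero] at h1
  have h3 : 0 < ‖(WithLp.toLp 2 v : Vec d)‖ := norm_pos_iff.2 (by simpa using hv)
  nlinarith [mul_pos hlam (pow_pos h3 2)]

/-- This is the source of the powers of `λ_min ^ (-1/2)`: three factors `b⁻¹` enter the Lipschitz
constant of the Stein matrix. -/
theorem norm_inv_bMat_le (S : IsMixing μ T g N M ρ C₂ C₃) (hlam : 0 < lambdaMin μ T g N) :
    ‖(bMat μ T g N)⁻¹‖ ≤ (√(lambdaMin μ T g N))⁻¹ := by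
  rw [Matrix.l2_opNorm_def]
  refine ContinuousLinearMap.opNorm_le_bound _ (by positivity) fun w => ?_
  change ‖mulVec (bMat μ T g N)⁻¹ w‖ ≤ _
  have hw : mulVec (bMat μ T g N) (mulVec (bMat μ T g N)⁻¹ w) = w := by
    simp [mulVec, Matrix.mulVec_mulVec, Matrix.mul_nonsing_inv _ (S.isUnit_bMat hlam)]
  set v := mulVec (bMat μ T g N)⁻¹ w
  have h1 := S.lambdaMin_mul_sq_le v
  rw [← S.norm_mulVec_bMat_sq hlam, hw] at h1
  have h2 : √(lambdaMin μ T g N) * ‖v‖ ≤ ‖w‖ := by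
    refine le_of_sq_le_sq ?_ (norm_nonneg w)
    rw [mul_pow, Real.sq_sqrt hlam.le]
    exact h1
  rw [inv_mul_eq_div, le_div_iff₀ (by positivity)]
  linarith

/-- Conjugation by `b⁻¹` cancels the covariance matrix `b ^ 2` under the trace. -/
theorem trace_conj_inv_bMat (S : IsMixing μ T g N M ρ C₂ C₃) (hlam : 0 < lambdaMin μ T g N)
    (B : Matrix (Fin d) (Fin d) ℝ) :
    ((bMat μ T g N)⁻¹.transpose * B * (bMat μ T g N)⁻¹ * covMat μ T g N).trace = B.trace := by
  have hu := S.isUnit_bMat hlam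
  rw [← S.bMat_mul_self hlam, Matrix.transpose_nonsing_inv, transpose_bMat,
    mul_assoc _ _ (_ * _), ← mul_assoc _ (bMat μ T g N) (bMat μ T g N),
    Matrix.nonsing_inv_mul _ hu, one_mul, Matrix.trace_mul_comm, ← mul_assoc,
    Matrix.mul_nonsing_inv _ hu, one_mul]

end IsMixing

omit [IsProbabilityMeasure μ] in
theorem W_eq (x : X) : W μ T g N x = mulVec (bMat μ T g N)⁻¹ (total μ T g N x) := by
  unfold W total
  ext i
  simp [mulVec, Matrix.mulVec_sum]

/-- The self-normalized sum has covariance `I`, hence second moment `d`. -/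
theorem IsMixing.integral_norm_sq_W (S : IsMixing μ T g N M ρ C₂ C₃)
    (hlam : 0 < lambdaMin μ T g N) : ∫ x, ‖W μ T g N x‖ ^ 2 ∂μ = d := by
  have : ∀ x, ‖W μ T g N x‖ ^ 2 = bilin (total μ T g N x)
      ((bMat μ T g N)⁻¹.transpose * 1 * (bMat μ T g N)⁻¹) (total μ T g N x) := fun x => by
    rw [W_eq, EuclideanSpace.real_norm_sq_eq, mul_one]
    simp only [bilin, mulVec]
    rw [← Matrix.mulVec_mulVec, Matrix.dotProduct_mulVec, ← Matrix.mulVec_transpose,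
      Matrix.transpose_transpose]
    simp [dotProduct, sq]
  simp_rw [this]
  rw [S.integral_bilin_total, S.trace_conj_inv_bMat hlam]
  simp

end Covariance

/-! ### Gaussian interpolation -/

section Interpolation

variable {X : Type*} [MeasurableSpace X] {d : ℕ} {μ : Measure X} [IsProbabilityMeasure μ]
  {h : Vec d → ℝ} {K : ℝ} {Y : X → Vec d} {KY : ℝ}

/-- The Gaussian interpolation between the law of `Y` (at `θ = 0`) and the standard Gaussian law
(at `θ = π / 2`). -/
noncomputable def interp (μ : Measure X) (h : Vec d → ℝ) (Y : X → Vec d) (θ : ℝ) : ℝ :=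
  ∫ x, gaussSmooth (Real.cos θ) (Real.sin θ) h (Y x) ∂μ

/-- The Gaussian radial derivative is a Laplacian, by integration by parts in each coordinate. -/
theorem IsSmoothTest.integral_fderiv_self (hh : IsSmoothTest h K) (a : Vec d) (s : ℝ) :
    ∫ z, fderiv ℝ h (a + s • z) z ∂stdGaussian (Vec d)
      = s * ∑ i, ∫ z, fderiv ℝ (fderiv ℝ h) (a + s • z) (EuclideanSpace.single i 1)
          (EuclideanSpace.single i 1) ∂stdGaussian (Vec d) := by
  have hc1 := hh.contDiff_one.continuous
  have e : ∀ z : Vec d, fderiv ℝ h (a + s • z) z = ∑ i, fderiv ℝ h (a + s • z)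
      (EuclideanSpace.single i 1) * inner ℝ z (EuclideanSpace.single i (1 : ℝ)) := fun z => by
    have hz : z = ∑ i, z i • EuclideanSpace.single i (1 : ℝ) := by
      ext j; simp [Pi.single_apply]
    conv_lhs => rw [hz, map_sum]
    refine Finset.sum_congr rfl fun i _ => ?_
    rw [map_smul, smul_eq_mul, mul_comm, EuclideanSpace.inner_single_right]
    rw [← hz]
    simp
  simp_rw [e]
  rw [integral_finsetSum _ fun i _ => integrable_mul_inner_stdGaussian (by fun_prop) (fun z =>
    (fderiv ℝ h (a + s • z)).le_of_opNorm_le (hh.bound_one _) _) _, Finset.mul_sum]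
  exact Finset.sum_congr rfl fun i _ => (integral_fderiv_two_apply hh a s _ _).symm

/-- The derivative of the interpolation is a Stein expression: by Gaussian integration by parts the
Gaussian component contributes a Laplacian. -/
theorem hasDerivAt_interp (hh : IsSmoothTest h K) (hY : Measurable Y) (hYb : ∀ x, ‖Y x‖ ≤ KY)
    (θ : ℝ) :
    HasDerivAt (interp μ h Y)
      (-Real.sin θ * (∫ x, gaussSmooth (Real.cos θ) (Real.sin θ) (fderiv ℝ h) (Y x) (Y x) ∂μ)
        + Real.cos θ * Real.sin θ * ∫ x, ∑ i, gaussSmooth (Real.cos θ) (Real.sin θ)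
          (fderiv ℝ (fderiv ℝ h)) (Y x) (EuclideanSpace.single i 1) (EuclideanSpace.single i 1) ∂μ)
      θ := by
  have hc := hh.contDiff.continuous
  have hc1 := hh.contDiff_one.continuous
  have hc2 := hh.contDiff_two.continuous
  let γ := stdGaussian (Vec d)
  have mp : ∀ c s : ℝ, Measurable fun p : X × Vec d => c • Y p.1 + s • p.2 := fun c s =>
    ((hY.comp measurable_fst).const_smul c).add (measurable_snd.const_smul s)
  have i0 : ∀ c s : ℝ, Integrable (fun p : X × Vec d => h (c • Y p.1 + s • p.2)) (μ.prod γ) :=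
    fun c s => Integrable.of_bound
      (hc.comp_aestronglyMeasurable (mp c s).aestronglyMeasurable) K
      (ae_of_all _ fun p => hh.bound _)
  have e0 : interp μ h Y = fun θ => ∫ p, h (Real.cos θ • Y p.1 + Real.sin θ • p.2) ∂μ.prod γ := by
    ext θ
    rw [integral_prod _ (i0 _ _)]
    rfl
  have iz : Integrable (fun p : X × Vec d => ‖p.2‖) (μ.prod γ) :=
    integrable_norm_stdGaussian.comp_snd μ
  set c := Real.cos θ
  set s := Real.sin θ
  have m1 : ∀ (c s : ℝ) (q : X × Vec d → Vec d), Measurable q →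
      AEStronglyMeasurable (fun p => fderiv ℝ h (c • Y p.1 + s • p.2) (q p)) (μ.prod γ) :=
    fun c s q hq =>
      (by fun_prop :
        Continuous fun p : (Vec d →L[ℝ] ℝ) × Vec d => p.1 p.2).comp_aestronglyMeasurable
        ((hc1.comp_aestronglyMeasurable (mp c s).aestronglyMeasurable).prodMk
          hq.aestronglyMeasurable)
  have b1 : ∀ x v, |fderiv ℝ h x v| ≤ ‖v‖ := fun x v =>
    ((fderiv ℝ h x).le_of_opNorm_le (hh.bound_one x) v).trans (by simp)
  have iY : Integrable (fun p : X × Vec d => fderiv ℝ h (c • Y p.1 + s • p.2) (Y p.1))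
      (μ.prod γ) :=
    Integrable.of_bound (m1 c s _ (hY.comp measurable_fst)) KY
      (ae_of_all _ fun p => (b1 _ _).trans (hYb _))
  have iZ : Integrable (fun p : X × Vec d => fderiv ℝ h (c • Y p.1 + s • p.2) p.2)
      (μ.prod γ) :=
    Integrable.mono' iz (m1 c s _ measurable_snd) (ae_of_all _ fun p => b1 _ _)
  have key := (hasDerivAt_integral_of_dominated_loc_of_deriv_le (μ := μ.prod γ) (s := Set.univ)
    (F := fun θ p => h (Real.cos θ • Y p.1 + Real.sin θ • p.2))
    (F' := fun θ p => fderiv ℝ h (Real.cos θ • Y p.1 + Real.sin θ • p.2)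
      ((-Real.sin θ) • Y p.1 + Real.cos θ • p.2)) (x₀ := θ)
    (bound := fun p => KY + ‖p.2‖) univ_mem
    (Eventually.of_forall fun u => (i0 _ _).aestronglyMeasurable) (i0 _ _)
    (m1 _ _ _ (mp _ _)) (ae_of_all _ fun p u _ => ?_) ((integrable_const _).add iz)
    (ae_of_all _ fun p u _ => ?_)).2
  · rw [← e0] at key
    refine key.congr_deriv ?_
    simp only [map_add, map_smul, smul_eq_mul]
    rw [integral_add (iY.const_mul _) (iZ.const_mul _), integral_const_mul, integral_const_mul,
      integral_prod _ iY, integral_prod _ iZ]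
    have i1 : ∀ a : Vec d, Integrable (fun z => fderiv ℝ h (a + s • z)) γ := fun a =>
      integrable_of_bounded_continuous (by fun_prop) fun z => hh.bound_one _
    have i2 : ∀ a : Vec d, Integrable (fun z => fderiv ℝ (fderiv ℝ h) (a + s • z)) γ := fun a =>
      integrable_of_bounded_continuous (by fun_prop) fun z => hh.bound_two _
    rw [mul_assoc (Real.cos θ)]
    congr 2
    · congr 1; ext x
      rw [gaussSmooth, ContinuousLinearMap.integral_apply (i1 _)]
    · rw [← integral_const_mul]
      congr 1; ext x
      refine (hh.integral_fderiv_self (c • Y x) s).trans ?_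
      congr 1
      refine Finset.sum_congr rfl fun i _ => ?_
      rw [gaussSmooth, ContinuousLinearMap.integral_apply (i2 _),
        ContinuousLinearMap.integral_apply ((i2 _).apply_continuousLinearMap _)]
  · refine (b1 _ _).trans ((norm_add_le _ _).trans (add_le_add ?_ ?_))
    · rw [norm_smul, norm_neg]
      exact (mul_le_of_le_one_left (norm_nonneg _) (Real.abs_sin_le_one u)).trans (hYb _)
    · rw [norm_smul]
      exact mul_le_of_le_one_left (norm_nonneg _) (Real.abs_cos_le_one u)
  · have h1 : HasDerivAt (fun θ : ℝ => Real.cos θ • Y p.1 + Real.sin θ • p.2)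
        ((-Real.sin u) • Y p.1 + Real.cos u • p.2) u :=
      ((Real.hasDerivAt_cos u).smul_const _).add ((Real.hasDerivAt_sin u).smul_const _)
    exact ((hh.contDiff.differentiable (by norm_num)) _).hasFDerivAt.comp_hasDerivAt u h1

theorem interp_pi_div_two (h : Vec d → ℝ) (Y : X → Vec d) :
    interp μ h Y (Real.pi / 2) = ∫ z, h z ∂stdGaussian (Vec d) := by
  simp [interp, gaussSmooth]

/-- Close to `θ = 0` the interpolation moves the law of `Y` only slightly. -/
theorem abs_interp_sub_le (hh : IsSmoothTest h K) (hY : Measurable Y) (hYb : ∀ x, ‖Y x‖ ≤ KY)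
    (hY2 : ∫ x, ‖Y x‖ ^ 2 ∂μ ≤ d) {θ : ℝ} (h0 : 0 ≤ θ) (h1 : θ ≤ Real.pi / 2) :
    |interp μ h Y θ - ∫ x, h (Y x) ∂μ| ≤ 2 * √d * Real.sin θ := by
  have hc := hh.contDiff.continuous
  have hs0 : 0 ≤ Real.sin θ := Real.sin_nonneg_of_nonneg_of_le_pi h0 (by linarith [Real.pi_pos])
  have hc0 : 0 ≤ Real.cos θ := Real.cos_nonneg_of_neg_pi_div_two_le_of_le (by linarith) h1
  have hs1 := Real.sin_le_one θ
  have hc1 := Real.cos_le_one θ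
  have hcs : 1 - Real.cos θ ≤ Real.sin θ := by nlinarith [Real.sin_sq_add_cos_sq θ]
  set c := Real.cos θ
  set s := Real.sin θ
  have lip : ∀ x y, |h x - h y| ≤ ‖x - y‖ := fun x y => by
    have := convex_univ.norm_image_sub_le_of_norm_fderiv_le (𝕜 := ℝ) (f := h) (C := 1)
      (fun x _ => hh.contDiff.differentiable (by norm_num) x) (fun x _ => hh.bound_one x)
      (Set.mem_univ y) (Set.mem_univ x)
    simpa using this
  have iY : Integrable (fun x => ‖Y x‖) μ :=
    Integrable.of_bound hY.norm.aestronglyMeasurable KY (ae_of_all _ fun x => by simpa using hYb x)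
  have iY2 : Integrable (fun x => ‖Y x‖ ^ 2) μ :=
    Integrable.of_bound (hY.norm.pow_const 2).aestronglyMeasurable (KY ^ 2)
      (ae_of_all _ fun x => by
        rw [norm_pow, norm_norm]; exact pow_le_pow_left₀ (norm_nonneg _) (hYb x) 2)
  have eY : ∫ x, ‖Y x‖ ∂μ ≤ √d := (integral_norm_le_sqrt iY iY2).trans (Real.sqrt_le_sqrt hY2)
  have eZ : ∫ z, ‖z‖ ∂stdGaussian (Vec d) ≤ √d := by
    have := integral_norm_le_sqrt (ν := stdGaussian (Vec d)) (q := fun z : Vec d => z)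
      integrable_norm_stdGaussian integrable_norm_sq_stdGaussian
    rwa [integral_norm_sq_stdGaussian, finrank_euclideanSpace_fin] at this
  have point : ∀ y : Vec d, |gaussSmooth c s h y - h y| ≤ s * ‖y‖ + s * √d := fun y => by
    have i1 : Integrable (fun z => h (c • y + s • z)) (stdGaussian (Vec d)) :=
      integrable_of_bounded_continuous (by fun_prop) fun z => hh.bound _
    have e : gaussSmooth c s h y - h y = ∫ z, (h (c • y + s • z) - h y) ∂stdGaussian (Vec d) := by
      rw [integral_sub i1 (integrable_const _)]
      simp [gaussSmooth]
    rw [e]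
    refine (norm_integral_le_of_norm_le (f := fun z => h (c • y + s • z) - h y)
      (g := fun z => s * ‖y‖ + s * ‖z‖)
      ((integrable_const _).add (integrable_norm_stdGaussian.const_mul s))
      (ae_of_all _ fun z => (lip _ _).trans ?_)).trans ?_
    · have : c • y + s • z - y = (c - 1) • y + s • z := by rw [sub_smul, one_smul]; abel
      rw [this]
      refine (norm_add_le _ _).trans ?_
      rw [norm_smul, norm_smul, Real.norm_eq_abs, Real.norm_of_nonneg hs0, abs_sub_comm,
        abs_of_nonneg (by linarith)]
      gcongr
    · rw [integral_add (integrable_const _) (integrable_norm_stdGaussian.const_mul s)]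
      simp only [integral_const, integral_const_mul, probReal_univ, smul_eq_mul, one_mul]
      gcongr
  have j1 : Integrable (fun x => gaussSmooth c s h (Y x)) μ :=
    Integrable.of_bound ((continuous_gaussSmooth c s hc hh.bound).comp_aestronglyMeasurable
      hY.aestronglyMeasurable) K (ae_of_all _ fun x => norm_gaussSmooth_le c s hh.bound _)
  have j2 : Integrable (fun x => h (Y x)) μ :=
    Integrable.of_bound (hc.comp_aestronglyMeasurable hY.aestronglyMeasurable) K
      (ae_of_all _ fun x => hh.bound _)
  change |(∫ x, gaussSmooth c s h (Y x) ∂μ) - _| ≤ _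
  rw [← integral_sub j1 j2]
  refine (norm_integral_le_of_norm_le (f := fun x => gaussSmooth c s h (Y x) - h (Y x))
      (g := fun x => s * ‖Y x‖ + s * √d) ((iY.const_mul s).add (integrable_const _))
      (ae_of_all _ fun x => point _)).trans ?_
  rw [integral_add (iY.const_mul s) (integrable_const _), integral_const_mul]
  simp only [integral_const, probReal_univ, smul_eq_mul, one_mul]
  nlinarith

/-- A bound `L cos θ / sin θ` on the derivative of the interpolation costs only a logarithm. -/
theorem abs_integral_sub_le_of_deriv (hh : IsSmoothTest h K) (hY : Measurable Y)
    (hYb : ∀ x, ‖Y x‖ ≤ KY) (hY2 : ∫ x, ‖Y x‖ ^ 2 ∂μ ≤ d) {L : ℝ}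
    (hL : ∀ θ ∈ Set.Ioo 0 (Real.pi / 2),
      |deriv (interp μ h Y) θ| ≤ L * (Real.cos θ / Real.sin θ))
    {σ : ℝ} (hσ0 : 0 < σ) (hσ1 : σ ≤ 1) :
    |(∫ x, h (Y x) ∂μ) - ∫ z, h z ∂stdGaussian (Vec d)| ≤ 2 * √d * σ + L * Real.log σ⁻¹ := by
  have hd := fun θ => hasDerivAt_interp (μ := μ) hh hY hYb θ
  set θ₀ := Real.arcsin σ
  have hs : Real.sin θ₀ = σ := Real.sin_arcsin (by linarith) hσ1
  have h0 : 0 < θ₀ := Real.arcsin_pos.2 hσ0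
  have h1 : θ₀ ≤ Real.pi / 2 := Real.arcsin_le_pi_div_two σ
  have hspos : ∀ θ ∈ Set.Icc θ₀ (Real.pi / 2), 0 < Real.sin θ := fun θ hθ =>
    Real.sin_pos_of_pos_of_lt_pi (h0.trans_le hθ.1) (by linarith [hθ.2, Real.pi_pos])
  -- `L log sin θ` has derivative `L cos θ / sin θ` and hence dominates `± Φ`.
  have mono : ∀ ε : ℝ, |ε| = 1 → MonotoneOn
      (fun θ => L * Real.log (Real.sin θ) - ε * interp μ h Y θ) (Set.Icc θ₀ (Real.pi / 2)) := by
    intro ε hε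
    have hder : ∀ θ ∈ Set.Icc θ₀ (Real.pi / 2),
        HasDerivAt (fun θ => L * Real.log (Real.sin θ) - ε * interp μ h Y θ)
          (L * (Real.cos θ / Real.sin θ) - ε * deriv (interp μ h Y) θ) θ := fun θ hθ =>
      (((Real.hasDerivAt_sin θ).log (hspos θ hθ).ne').const_mul L).sub
        ((hd θ).differentiableAt.hasDerivAt.const_mul ε)
    refine monotoneOn_of_deriv_nonneg (convex_Icc _ _)
      (fun θ hθ => (hder θ hθ).continuousAt.continuousWithinAt)
      (fun θ hθ => (hder θ (interior_subset hθ)).differentiableAt.differentiableWithinAt)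
      fun θ hθ => ?_
    rw [(hder θ (interior_subset hθ)).deriv]
    rw [interior_Icc] at hθ
    have := hL θ ⟨h0.trans hθ.1, hθ.2⟩
    have h2 : ε * deriv (interp μ h Y) θ ≤ |deriv (interp μ h Y) θ| := by
      refine (le_abs_self _).trans ?_
      rw [abs_mul, hε, one_mul]
    linarith
  have hl := Set.left_mem_Icc.2 h1
  have hr := Set.right_mem_Icc.2 h1
  have m1 := mono 1 (by simp) hl hr h1
  have m2 := mono (-1) (by simp) hl hr h1
  have hb := abs_interp_sub_le (μ := μ) hh hY hYb hY2 h0.le h1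
  simp only [hs, Real.sin_pi_div_two, Real.log_one, interp_pi_div_two] at m1 m2 hb
  rw [Real.log_inv]
  rw [abs_le] at hb ⊢
  constructor <;> linarith [hb.1, hb.2]

end Interpolation

/-! ### The Stein field of the self-normalized sum -/

section Pullback

variable {d : ℕ}

/-- The gradient of `ℓ ∘ P` for a linear form `ℓ`. -/
noncomputable def pullVec (P : Matrix (Fin d) (Fin d) ℝ) : (Vec d →L[ℝ] ℝ) →L[ℝ] Vec d :=
  LinearMap.toContinuousLinearMap
    { toFun := fun ℓ => WithLp.toLp 2 fun i => ℓ (mulVec P (EuclideanSpace.single i 1))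
      map_add' := fun ℓ ℓ' => by ext i; simp
      map_smul' := fun a ℓ => by ext i; simp }

/-- The matrix of `(u, v) ↦ B (P v) (P u)` for a bilinear form `B`. The column index belongs to the
first argument of `B`, which is the direction of the outer derivative when `B` is a second
derivative, so that `pullMat P (D²f)` is the Jacobian of `x ↦ pullVec P (Df (P x))`. -/
noncomputable def pullMat (P : Matrix (Fin d) (Fin d) ℝ) :
    (Vec d →L[ℝ] Vec d →L[ℝ] ℝ) →L[ℝ] Matrix (Fin d) (Fin d) ℝ :=
  LinearMap.toContinuousLinearMap
    { toFun := fun B => Matrix.of fun i j =>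
        B (mulVec P (EuclideanSpace.single j 1)) (mulVec P (EuclideanSpace.single i 1))
      map_add' := fun B B' => by ext i j; simp
      map_smul' := fun a B => by ext i j; simp }

theorem pullVec_apply (P : Matrix (Fin d) (Fin d) ℝ) (ℓ : Vec d →L[ℝ] ℝ) (i : Fin d) :
    pullVec P ℓ i = ℓ (mulVec P (EuclideanSpace.single i 1)) := rfl

theorem pullMat_apply (P : Matrix (Fin d) (Fin d) ℝ) (B : Vec d →L[ℝ] Vec d →L[ℝ] ℝ)
    (i j : Fin d) : pullMat P B i j =
      B (mulVec P (EuclideanSpace.single j 1)) (mulVec P (EuclideanSpace.single i 1)) := rfl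

theorem mulVec_eq_toEuclideanCLM (P : Matrix (Fin d) (Fin d) ℝ) (v : Vec d) :
    mulVec P v = Matrix.toEuclideanCLM (𝕜 := ℝ) P v := rfl

theorem eq_sum_single (v : Vec d) : v = ∑ i, v i • EuclideanSpace.single i (1 : ℝ) := by
  ext j; simp [Pi.single_apply]

theorem mulVec_eq_sum_single (P : Matrix (Fin d) (Fin d) ℝ) (v : Vec d) :
    mulVec P v = ∑ i, v i • mulVec P (EuclideanSpace.single i (1 : ℝ)) := by
  simp_rw [mulVec_eq_toEuclideanCLM]
  conv_lhs => rw [eq_sum_single v]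
  rw [map_sum]
  simp_rw [map_smul]

theorem inner_pullVec (P : Matrix (Fin d) (Fin d) ℝ) (ℓ : Vec d →L[ℝ] ℝ) (v : Vec d) :
    inner ℝ v (pullVec P ℓ) = ℓ (mulVec P v) := by
  rw [mulVec_eq_sum_single, map_sum, PiLp.inner_apply]
  refine Finset.sum_congr rfl fun i _ => ?_
  rw [pullVec_apply, map_smul]
  simp [mul_comm]

theorem mulVec_pullMat (P : Matrix (Fin d) (Fin d) ℝ) (B : Vec d →L[ℝ] Vec d →L[ℝ] ℝ)
    (v : Vec d) : mulVec (pullMat P B) v = pullVec P (B (mulVec P v)) := by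
  ext i
  rw [pullVec_apply, mulVec_eq_sum_single P v, map_sum]
  simp [mulVec, Matrix.mulVec, dotProduct, pullMat_apply, mul_comm]

theorem norm_pullVec_le (P : Matrix (Fin d) (Fin d) ℝ) (ℓ : Vec d →L[ℝ] ℝ) :
    ‖pullVec P ℓ‖ ≤ ‖P‖ * ‖ℓ‖ := by
  have h := inner_pullVec P ℓ (pullVec P ℓ)
  rw [real_inner_self_eq_norm_sq] at h
  have h2 : ℓ (mulVec P (pullVec P ℓ)) ≤ ‖ℓ‖ * (‖P‖ * ‖pullVec P ℓ‖) :=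
    (le_abs_self _).trans ((ℓ.le_opNorm _).trans (by gcongr; exact norm_mulVec_le _ _))
  rcases (norm_nonneg (pullVec P ℓ)).eq_or_lt with h0 | h0
  · rw [← h0]; positivity
  · nlinarith

theorem norm_pullMat_le (P : Matrix (Fin d) (Fin d) ℝ) (B : Vec d →L[ℝ] Vec d →L[ℝ] ℝ) :
    ‖pullMat P B‖ ≤ ‖P‖ ^ 2 * ‖B‖ := by
  rw [Matrix.l2_opNorm_def]
  refine ContinuousLinearMap.opNorm_le_bound _ (by positivity) fun v => ?_
  change ‖mulVec (pullMat P B) v‖ ≤ _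
  rw [mulVec_pullMat]
  calc _ ≤ ‖P‖ * (‖B‖ * (‖P‖ * ‖v‖)) := by
        refine (norm_pullVec_le _ _).trans ?_
        gcongr
        exact (B.le_opNorm _).trans (by gcongr; exact norm_mulVec_le _ _)
    _ = _ := by ring

theorem pullMat_eq_conj (P : Matrix (Fin d) (Fin d) ℝ) (B : Vec d →L[ℝ] Vec d →L[ℝ] ℝ) :
    pullMat P B = P.transpose * pullMat 1 B * P := by
  have h1 : ∀ v : Vec d, mulVec 1 v = v := fun v => by simp [mulVec]
  ext i j
  have e : ∀ k, mulVec P (EuclideanSpace.single k 1)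
      = ∑ l, P l k • EuclideanSpace.single l (1 : ℝ) := fun k => by
    rw [eq_sum_single (mulVec P _)]
    simp [mulVec]
  rw [pullMat_apply, e, e, map_sum]
  simp only [Matrix.mul_apply, Matrix.transpose_apply, pullMat_apply, h1, map_smul,
    map_sum, sum_apply, smul_apply, smul_eq_mul, Finset.sum_mul, Finset.mul_sum]
  rw [Finset.sum_comm]
  refine Finset.sum_congr rfl fun k _ => Finset.sum_congr rfl fun l _ => ?_
  ring

theorem trace_pullMat_one (B : Vec d →L[ℝ] Vec d →L[ℝ] ℝ) : (pullMat 1 B).trace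
    = ∑ i, B (EuclideanSpace.single i 1) (EuclideanSpace.single i 1) := by
  have h1 : ∀ v : Vec d, mulVec 1 v = v := fun v => by simp [mulVec]
  simp [Matrix.trace, pullMat_apply, h1]

end Pullback

section SteinField

variable {d : ℕ} {h : Vec d → ℝ} {K : ℝ}

/-- The Stein vector field `x ↦ Pᵀ F(P x)`, where `F` is the Gaussian average of the gradient of `h`
at parameters `c, s`. It acts on the sum before its normalization by `P`. -/
noncomputable def steinField (h : Vec d → ℝ) (P : Matrix (Fin d) (Fin d) ℝ) (c s : ℝ)
    (x : Vec d) : Vec d :=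
  pullVec P (gaussSmooth c s (fderiv ℝ h) (mulVec P x))

/-- The Jacobian of `steinField`. -/
noncomputable def steinMatrix (h : Vec d → ℝ) (P : Matrix (Fin d) (Fin d) ℝ) (c s : ℝ)
    (x : Vec d) : Matrix (Fin d) (Fin d) ℝ :=
  pullMat P (c • gaussSmooth c s (fderiv ℝ (fderiv ℝ h)) (mulVec P x))

theorem hasFDerivAt_steinField (hh : IsSmoothTest h K) (P : Matrix (Fin d) (Fin d) ℝ) (c s : ℝ)
    (x : Vec d) : HasFDerivAt (steinField h P c s)
      (Matrix.toEuclideanCLM (𝕜 := ℝ) (steinMatrix h P c s x)) x := by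
  have h1 := hasFDerivAt_gaussSmooth c s (hh.contDiff_one.of_le (by norm_num)) hh.bound_one
    hh.bound_two (mulVec P x)
  have h2 := h1.comp x (Matrix.toEuclideanCLM (𝕜 := ℝ) P).hasFDerivAt
  have h3 := (pullVec P).hasFDerivAt.comp x h2
  refine h3.congr_fderiv ?_
  ext1 v
  exact (mulVec_pullMat P (c • gaussSmooth c s (fderiv ℝ (fderiv ℝ h)) (mulVec P x)) v).symm

/-- The Lipschitz constant of the Jacobian does not involve the bound `K` on the derivatives of `h`
of higher order. -/
theorem isLipMatrix_steinMatrix (hh : IsSmoothTest h K) (P : Matrix (Fin d) (Fin d) ℝ) (c : ℝ)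
    {s : ℝ} (hs : 0 < s) :
    IsLipMatrix (steinMatrix h P c s) (‖P‖ ^ 2 * (|c| * K))
      (c ^ 2 * ‖P‖ ^ 3 * ((d + 1) / s ^ 2)) := by
  have hder : ∀ x, HasFDerivAt (steinMatrix h P c s)
      ((pullMat P).comp ((c • c • gaussSmooth c s (fderiv ℝ (fderiv ℝ (fderiv ℝ h)))
        (mulVec P x)).comp (Matrix.toEuclideanCLM (𝕜 := ℝ) P))) x := fun x => by
    have h1 := (hasFDerivAt_gaussSmooth c s hh.contDiff_two hh.bound_two
      hh.bound_three (mulVec P x)).const_smul c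
    have h2 := h1.comp x (Matrix.toEuclideanCLM (𝕜 := ℝ) P).hasFDerivAt
    exact (pullMat P).hasFDerivAt.comp x h2
  refine ⟨?_, fun x => ?_, fun x => ?_⟩
  · refine contDiff_one_iff_hasFDerivAt.2 ⟨_, ?_, hder⟩
    have hc := continuous_gaussSmooth c s hh.continuous_three hh.bound_three
    have hc2 : Continuous fun x =>
        gaussSmooth c s (fderiv ℝ (fderiv ℝ (fderiv ℝ h))) (mulVec P x) :=
      hc.comp (Matrix.toEuclideanCLM (𝕜 := ℝ) P).continuous
    exact continuous_const.clm_comp (((hc2.const_smul c).const_smul c).clm_comp continuous_const)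
  · refine (norm_pullMat_le _ _).trans ?_
    rw [norm_smul]
    gcongr
    · exact le_rfl
    · exact norm_gaussSmooth_le c s hh.bound_two _
  · rw [(hder x).fderiv]
    refine ContinuousLinearMap.opNorm_le_bound _ (by positivity) fun v => ?_
    refine (norm_pullMat_le _ _).trans ?_
    have h3 := norm_gaussSmooth_fderiv_three_le hh c hs (mulVec P x)
    rw [finrank_euclideanSpace_fin] at h3
    set G := gaussSmooth c s (fderiv ℝ (fderiv ℝ (fderiv ℝ h))) (mulVec P x)
    have h4 : ‖(c • c • G) (mulVec P v)‖ ≤ c ^ 2 * ((d + 1) / s ^ 2 * (‖P‖ * ‖v‖)) := by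
      rw [smul_apply, smul_apply, smul_smul, norm_smul, Real.norm_of_nonneg (mul_self_nonneg c),
        ← sq]
      gcongr
      exact ContinuousLinearMap.le_of_opNorm_le_of_le _ h3 (norm_mulVec_le P v)
    calc _ ≤ ‖P‖ ^ 2 * (c ^ 2 * ((d + 1) / s ^ 2 * (‖P‖ * ‖v‖))) := by gcongr; exact h4
      _ = _ := by ring

end SteinField

section DerivBound

variable {X : Type*} [MeasurableSpace X] {d : ℕ} {μ : Measure X} [IsProbabilityMeasure μ]
  {T : ℕ → X → X} {g : ℕ → X → Vec d} {N : ℕ} {M : ℝ} {ρ : ℕ → ℝ} {C₂ C₃ : ℝ}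
  {h : Vec d → ℝ} {K : ℝ}

omit [IsProbabilityMeasure μ] in
theorem IsMixing.measurable_W (S : IsMixing μ T g N M ρ C₂ C₃) : Measurable (W μ T g N) := by
  have : W μ T g N = fun x => Matrix.toEuclideanCLM (𝕜 := ℝ) (bMat μ T g N)⁻¹ (total μ T g N x) :=
    funext fun x => W_eq x
  rw [this]
  exact (Matrix.toEuclideanCLM (𝕜 := ℝ) (bMat μ T g N)⁻¹).continuous.measurable.comp
    (measurable_total S.measurable_map S.measurable_obs N)

theorem IsMixing.norm_W_le (S : IsMixing μ T g N M ρ C₂ C₃) (x : X) :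
    ‖W μ T g N x‖ ≤ ‖(bMat μ T g N)⁻¹‖ * (2 * M * N) := by
  rw [W_eq]
  exact (norm_mulVec_le _ _).trans (by gcongr; exact norm_total_le S.norm_le x)

/-- The derivative of the interpolation for the self-normalized sum is controlled by the Stein
bound, since self-normalization turns the covariance term into the Laplacian. -/
theorem IsMixing.abs_deriv_interp_le (S : IsMixing μ T g N M ρ C₂ C₃)
    (hlam : 0 < lambdaMin μ T g N) (hN : 1 ≤ N) {R : ℝ} (hR1 : 1 ≤ R)
    (hR : ∑ m ∈ Finset.Ico 1 N, m * ρ m ≤ R) (hh : IsSmoothTest h K)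
    {θ : ℝ} (hθ : θ ∈ Set.Ioo 0 (Real.pi / 2)) :
    |deriv (interp μ h (W μ T g N)) θ| ≤
      N * (31 * (C₂ + C₃) * (M * (‖(bMat μ T g N)⁻¹‖ ^ 3 * (d + 1))) * (1 + ρ 0) * R)
        * (Real.cos θ / Real.sin θ) := by
  have hs : 0 < Real.sin θ :=
    Real.sin_pos_of_pos_of_lt_pi hθ.1 (by linarith [hθ.2, Real.pi_pos])
  have hc0 : 0 < Real.cos θ := Real.cos_pos_of_mem_Ioo ⟨by linarith [hθ.1, Real.pi_pos], hθ.2⟩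
  have hc1 := Real.cos_le_one θ
  rw [(hasDerivAt_interp hh S.measurable_W S.norm_W_le θ).deriv]
  set c := Real.cos θ
  set s := Real.sin θ
  set P := (bMat μ T g N)⁻¹ with hP
  have hA := isLipMatrix_steinMatrix hh P c hs
  have hst := S.stein_bound hA (hasFDerivAt_steinField hh P c s) (KF := ‖P‖ * 1)
    (fun x => (norm_pullVec_le _ _).trans
      (by gcongr; exact norm_gaussSmooth_le c s hh.bound_one _)) hN hR1 hR
  have iA := hA.integrable_comp (μ := μ)
    (measurable_total (μ := μ) S.measurable_map S.measurable_obs N)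
  have e1 : ∫ x, (inner ℝ (total μ T g N x) (steinField h P c s (total μ T g N x)) : ℝ) ∂μ
      = ∫ x, gaussSmooth c s (fderiv ℝ h) (W μ T g N x) (W μ T g N x) ∂μ := by
    congr 1; ext x
    rw [steinField, inner_pullVec, W_eq]
  have e2 : ∫ x, bilin (total μ T g N x) (∫ y, steinMatrix h P c s (total μ T g N y) ∂μ)
        (total μ T g N x) ∂μ
      = c * ∫ x, ∑ i, gaussSmooth c s (fderiv ℝ (fderiv ℝ h)) (W μ T g N x)
          (EuclideanSpace.single i 1) (EuclideanSpace.single i 1) ∂μ := by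
    rw [S.integral_bilin_total, ← integral_const_mul]
    have := (LinearMap.toContinuousLinearMap ((Matrix.traceLinearMap (Fin d) ℝ ℝ).comp
      (LinearMap.mulRight ℝ (covMat μ T g N)))).integral_comp_comm iA
    simp only [LinearMap.coe_toContinuousLinearMap', LinearMap.comp_apply,
      LinearMap.mulRight_apply, Matrix.traceLinearMap_apply] at this
    rw [← this]
    congr 1; ext x
    rw [steinMatrix, pullMat_eq_conj, hP, S.trace_conj_inv_bMat hlam, trace_pullMat_one,
      Finset.mul_sum, W_eq]
    rfl
  rw [e1, e2] at hst
  set I₁ := ∫ x, gaussSmooth c s (fderiv ℝ h) (W μ T g N x) (W μ T g N x) ∂μ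
  set I₂ := ∫ x, ∑ i, gaussSmooth c s (fderiv ℝ (fderiv ℝ h)) (W μ T g N x)
          (EuclideanSpace.single i 1) (EuclideanSpace.single i 1) ∂μ
  -- The factor `sin θ` cancels one of the two powers of `sin θ` in the Lipschitz constant.
  have e3 : -s * I₁ + c * s * I₂ = -s * (I₁ - c * I₂) := by ring
  rw [e3, abs_mul, abs_neg, abs_of_pos hs]
  have hnn : 0 ≤ N * (31 * (C₂ + C₃) * (M * (‖P‖ ^ 3 * (d + 1))) * (1 + ρ 0) * R) := by
    have := S.nonneg₂
    have := S.nonneg₃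
    have := S.rate_nonneg 0
    have := S.one_le
    positivity
  calc s * |I₁ - c * I₂| ≤ s * (N * (31 * (C₂ + C₃) * (M * (c ^ 2 * ‖P‖ ^ 3
        * ((d + 1) / s ^ 2))) * (1 + ρ 0) * R)) := by gcongr
    _ = N * (31 * (C₂ + C₃) * (M * (‖P‖ ^ 3 * (d + 1))) * (1 + ρ 0) * R) * (c / s) * c := by
        field_simp
    _ ≤ _ := mul_le_of_le_one_right (by positivity) hc1

end DerivBound

/-! ### Reduction to smooth test functions -/

section LipschitzApproximation

variable {E : Type*} [NormedAddCommGroup E] [InnerProductSpace ℝ E] [FiniteDimensional ℝ E]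
  [MeasurableSpace E] [BorelSpace E] {f : E → ℝ}

open scoped Convolution in
/-- Mollification by a bump function keeps the Lipschitz constant. -/
theorem LipschitzWith.exists_isSmoothTest_near (hf : LipschitzWith 1 f) (hfc : HasCompactSupport f)
    {ε : ℝ} (hε : 0 < ε) : ∃ (h : E → ℝ) (K : ℝ), IsSmoothTest h K ∧ ∀ x, |h x - f x| ≤ ε := by
  let φ : ContDiffBump (0 : E) := ⟨ε / 2, ε, half_pos hε, half_lt_self hε⟩
  let h : E → ℝ := φ.normed volume ⋆[ContinuousLinearMap.lsmul ℝ ℝ, volume] f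
  have hfl : LocallyIntegrable f volume := hf.continuous.locallyIntegrable
  have hsm : ContDiff ℝ 3 h := by
    have := (φ.hasCompactSupport_normed (μ := volume)).contDiff_convolution_left
      (n := 3) (μ := volume) (ContinuousLinearMap.lsmul ℝ ℝ) φ.contDiff_normed hfl
    exact_mod_cast this
  have hcs : HasCompactSupport h :=
    HasCompactSupport.convolution (ContinuousLinearMap.lsmul ℝ ℝ) φ.hasCompactSupport_normed hfc
  have hnear : ∀ x, |h x - f x| ≤ ε := fun x => by
    refine φ.dist_normed_convolution_le hf.continuous.aestronglyMeasurable fun y hy => ?_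
    have := hf.dist_le_mul y x
    rw [NNReal.coe_one, one_mul] at this
    exact this.trans (Metric.mem_ball.1 hy).le
  have hlip : LipschitzWith 1 h := by
    refine LipschitzWith.of_dist_le_mul fun x y => ?_
    have hint : ∀ x, Integrable (fun t => φ.normed volume t • f (x - t)) := fun x =>
      φ.hasCompactSupport_normed.convolutionExists_left (ContinuousLinearMap.lsmul ℝ ℝ)
        φ.continuous_normed hfl x
    have e : h x - h y = ∫ t, (φ.normed volume t • f (x - t) - φ.normed volume t • f (y - t)) :=
      (integral_sub (hint x) (hint y)).symm
    rw [Real.dist_eq, e, NNReal.coe_one, one_mul]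
    refine (norm_integral_le_of_norm_le
      (f := fun t => φ.normed volume t • f (x - t) - φ.normed volume t • f (y - t))
      (φ.integrable_normed.mul_const (dist x y)) (ae_of_all _ fun t => ?_)).trans ?_
    · rw [← smul_sub, norm_smul, Real.norm_of_nonneg (φ.nonneg_normed t)]
      refine mul_le_mul_of_nonneg_left ?_ (φ.nonneg_normed t)
      have := hf.dist_le_mul (x - t) (y - t)
      rwa [NNReal.coe_one, one_mul, dist_sub_right, Real.dist_eq] at this
    · rw [integral_mul_const, φ.integral_normed, one_mul]
  have c1 : ContDiff ℝ 2 (fderiv ℝ h) := hsm.fderiv_right (by norm_num)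
  have c2 : ContDiff ℝ 1 (fderiv ℝ (fderiv ℝ h)) := c1.fderiv_right (by norm_num)
  obtain ⟨K₀, h₀⟩ := hsm.continuous.bounded_above_of_compact_support hcs
  obtain ⟨K₂, h₂⟩ := c2.continuous.bounded_above_of_compact_support
    ((hcs.fderiv (𝕜 := ℝ)).fderiv (𝕜 := ℝ))
  obtain ⟨K₃, h₃⟩ := (c2.continuous_fderiv one_ne_zero).bounded_above_of_compact_support
    (((hcs.fderiv (𝕜 := ℝ)).fderiv (𝕜 := ℝ)).fderiv (𝕜 := ℝ))
  refine ⟨h, max K₀ (max K₂ K₃), ⟨hsm, fun x => (h₀ x).trans (le_max_left _ _), fun x => ?_,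
    fun x => (h₂ x).trans ((le_max_left _ _).trans (le_max_right _ _)),
    fun x => (h₃ x).trans ((le_max_right _ _).trans (le_max_right _ _))⟩, hnear⟩
  simpa using norm_fderiv_le_of_lipschitz ℝ hlip

/-- The truncation of `f` to `[-r, r]` with `r = (R - ‖x‖)⁺`: it keeps the Lipschitz constant and
makes the support compact. -/
noncomputable def truncate (f : E → ℝ) (R : ℝ) (x : E) : ℝ :=
  max (-max 0 (R - ‖x‖)) (min (f x) (max 0 (R - ‖x‖)))

omit [InnerProductSpace ℝ E] [FiniteDimensional ℝ E] [MeasurableSpace E] [BorelSpace E] in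
theorem lipschitzWith_truncate (hf : LipschitzWith 1 f) (R : ℝ) :
    LipschitzWith 1 (truncate f R) := by
  have h1 : LipschitzWith 1 fun x : E => max 0 (R - ‖x‖) := by
    have : LipschitzWith 1 fun x : E => R - ‖x‖ := by
      simpa using (LipschitzWith.const R).sub (lipschitzWith_one_norm (E := E))
    exact this.const_max 0
  have h2 := h1.neg.max (hf.min h1)
  simp only [max_self] at h2
  exact h2

omit [MeasurableSpace E] [BorelSpace E] in
theorem hasCompactSupport_truncate (f : E → ℝ) (R : ℝ) : HasCompactSupport (truncate f R) := by
  refine HasCompactSupport.of_support_subset_isCompact (isCompact_closedBall (0 : E) R)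
    fun x hx => ?_
  by_contra hxR
  rw [mem_closedBall_zero_iff, not_le] at hxR
  refine hx ?_
  rw [truncate, max_eq_left (by linarith : R - ‖x‖ ≤ 0)]
  simp

omit [InnerProductSpace ℝ E] [FiniteDimensional ℝ E] [MeasurableSpace E] [BorelSpace E] in
theorem abs_truncate_le (f : E → ℝ) (R : ℝ) (x : E) : |truncate f R x| ≤ |f x| := by
  have h0 : (0 : ℝ) ≤ max 0 (R - ‖x‖) := le_max_left _ _
  rw [truncate]
  generalize max 0 (R - ‖x‖) = r at h0 ⊢
  rw [abs_le]
  constructor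
  · exact le_max_of_le_right (le_min (neg_abs_le _) (by linarith [abs_nonneg (f x)]))
  · exact max_le (by linarith [abs_nonneg (f x)]) ((min_le_left _ _).trans (le_abs_self _))

omit [InnerProductSpace ℝ E] [FiniteDimensional ℝ E] [MeasurableSpace E] [BorelSpace E] in
theorem tendsto_truncate (f : E → ℝ) (x : E) :
    Tendsto (fun n : ℕ => truncate f n x) atTop (𝓝 (f x)) := by
  obtain ⟨n₀, hn₀⟩ := exists_nat_ge (|f x| + ‖x‖)
  refine tendsto_const_nhds.congr' ?_
  filter_upwards [eventually_ge_atTop n₀] with n hn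
  have h1 : |f x| ≤ max 0 ((n : ℝ) - ‖x‖) :=
    le_max_of_le_right (by have : (n₀ : ℝ) ≤ n := by exact_mod_cast hn
                           linarith)
  rw [truncate, min_eq_left ((le_abs_self _).trans h1), max_eq_right]
  linarith [neg_abs_le (f x)]

/-- Smooth test functions determine the Wasserstein distance of laws with finite first moment: they
approximate compactly supported Lipschitz functions uniformly, and the truncations of a Lipschitz
function converge to it with the integrable bound `‖x‖`. -/
theorem wassersteinDist_le_of_isSmoothTest {P Q : Measure E} [IsProbabilityMeasure P]
    [IsProbabilityMeasure Q] (hP : Integrable (fun x => ‖x‖) P) (hQ : Integrable (fun x => ‖x‖) Q)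
    {B : ℝ} (hB : ∀ (h : E → ℝ) (K : ℝ), IsSmoothTest h K → |∫ x, h x ∂P - ∫ x, h x ∂Q| ≤ B) :
    wassersteinDist P Q ≤ ENNReal.ofReal B := by
  refine iSup₂_le fun f hf => ENNReal.ofReal_le_ofReal ?_
  have hcompact : ∀ u : E → ℝ, LipschitzWith 1 u → HasCompactSupport u →
      |∫ x, u x ∂P - ∫ x, u x ∂Q| ≤ B := by
    intro u hu huc
    refine le_of_forall_pos_le_add fun ε hε => ?_
    obtain ⟨h, K, hh, hnear⟩ := hu.exists_isSmoothTest_near huc (half_pos hε)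
    have key : ∀ (ν : Measure E) [IsProbabilityMeasure ν],
        |∫ x, h x ∂ν - ∫ x, u x ∂ν| ≤ ε / 2 := fun ν _ => by
      have ih : Integrable h ν := integrable_of_bounded_continuous hh.contDiff.continuous hh.bound
      have iu : Integrable u ν := hu.continuous.integrable_of_hasCompactSupport huc
      rw [← integral_sub ih iu]
      simpa using norm_integral_le_of_norm_le_const (μ := ν) (f := fun x => h x - u x)
        (ae_of_all _ hnear)
    have k1 := abs_le.1 (key P)
    have k2 := abs_le.1 (key Q)
    have k3 := abs_le.1 (hB h K hh)
    rw [abs_le]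
    constructor <;> linarith [k1.1, k1.2, k2.1, k2.2, k3.1, k3.2]
  set u : E → ℝ := fun x => f x - f 0 with hu
  have hul : LipschitzWith 1 u := by
    simpa using hf.sub (LipschitzWith.const (f 0))
  have hub : ∀ x, |u x| ≤ ‖x‖ := fun x => by
    have := hf.dist_le_mul x 0
    simpa [Real.dist_eq] using this
  have lim : ∀ (ν : Measure E) [IsProbabilityMeasure ν], Integrable (fun x => ‖x‖) ν →
      Tendsto (fun n : ℕ => ∫ x, truncate u n x ∂ν) atTop (𝓝 (∫ x, u x ∂ν)) := fun ν _ hν =>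
    tendsto_integral_of_dominated_convergence (fun x => ‖x‖)
      (fun n => (lipschitzWith_truncate hul n).continuous.aestronglyMeasurable) hν
      (fun n => ae_of_all _ fun x => (abs_truncate_le u n x).trans (hub x))
      (ae_of_all _ fun x => tendsto_truncate u x)
  have hu' : |∫ x, u x ∂P - ∫ x, u x ∂Q| ≤ B :=
    le_of_tendsto ((lim P hP).sub (lim Q hQ)).abs (Eventually.of_forall fun n =>
      hcompact _ (lipschitzWith_truncate hul n) (hasCompactSupport_truncate u n))
  have shift : ∀ (ν : Measure E) [IsProbabilityMeasure ν], Integrable (fun x => ‖x‖) ν →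
      ∫ x, u x ∂ν = ∫ x, f x ∂ν - f 0 := fun ν _ hν => by
    have iu : Integrable u ν := Integrable.mono' hν hul.continuous.aestronglyMeasurable
      (ae_of_all _ hub)
    have : ∀ x, f x = u x + f 0 := fun x => by simp [hu]
    rw [integral_congr_ae (ae_of_all ν this), integral_add iu (integrable_const _)]
    simp
  rwa [shift P hP, shift Q hQ, sub_sub_sub_cancel_right] at hu'

end LipschitzApproximation

/-! ### Collecting the constants -/

section Constants

/-- The logarithmic weights in `rhoSum` are at least `1` because `ρ ≤ 1` on the positive integers;
a term with `ρ m = 0` vanishes on both sides. -/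
theorem sum_mul_le_rhoSum {N : ℕ} {ρ : ℕ → ℝ} (hρ : ∀ n, 0 ≤ ρ n) (hanti : Antitone ρ)
    (h1 : ρ 1 ≤ 1) : ∑ m ∈ Finset.Ico 1 N, m * ρ m ≤ rhoSum N ρ := by
  refine Finset.sum_le_sum fun m hm => ?_
  have hm1 : ρ m ≤ 1 := (hanti (Finset.mem_Ico.1 hm).1).trans h1
  rw [mul_assoc]
  refine le_mul_of_one_le_left (mul_nonneg (Nat.cast_nonneg _) (hρ m)) ?_
  rw [Real.log_inv]
  linarith [Real.log_nonpos (hρ m) hm1]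

/-- The part of the explicit constant that is actually needed. -/
theorem le_Cstar {d : ℕ} (hd : 1 ≤ d) {M ρ₀ C₁ C₂ C₃ : ℝ} (hM : 1 ≤ M) (hρ : 0 ≤ ρ₀)
    (hC₁ : 0 ≤ C₁) (hC₂ : 0 ≤ C₂) (hC₃ : 0 ≤ C₃) :
    4038 * (d : ℝ) * M ^ 3 * ((C₂ + C₃) * (1 + ρ₀) + 1) ≤ Cstar d M ρ₀ C₁ C₂ C₃ := by
  have hd' : (1 : ℝ) ≤ d := by exact_mod_cast hd
  have hΓ : 0 ≤ (8 + 16 * (d : ℝ)) / d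
      * (Real.Gamma ((1 + (d : ℝ)) / 2) / Real.Gamma ((d : ℝ) / 2)) := by
    have := Real.Gamma_pos_of_pos (s := (1 + (d : ℝ)) / 2) (by positivity)
    have := Real.Gamma_pos_of_pos (s := (d : ℝ) / 2) (by positivity)
    positivity
  have h1 : 2 ≤ (8 + 16 * (d : ℝ)) / d
      * (Real.Gamma ((1 + (d : ℝ)) / 2) / Real.Gamma ((d : ℝ) / 2)) + √(d : ℝ) * (4 * M) + 2 := by
    have : 0 ≤ √(d : ℝ) * (4 * M) := by positivity
    linarith
  have h2 : 2019 * (d : ℝ) * M ^ 3 ≤ 2019 * (d : ℝ) ^ 2 * 4 ^ d * M ^ 4 := by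
    have h3 : (d : ℝ) ≤ d ^ 2 := by nlinarith
    have h4 : (1 : ℝ) ≤ 4 ^ d := one_le_pow₀ (by norm_num)
    have h5 : M ^ 3 ≤ M ^ 4 := pow_le_pow_right₀ hM (by norm_num)
    calc 2019 * (d : ℝ) * M ^ 3 = 2019 * (d : ℝ) * 1 * M ^ 3 := by ring
      _ ≤ _ := by gcongr
  have h6 : (C₂ + C₃) * (1 + ρ₀) + 1 ≤ (C₂ + C₃) * (1 + ρ₀⁻¹) * (2 * ρ₀ + 1) + C₁ + 1 := by
    have h7 : 1 + ρ₀ ≤ (1 + ρ₀⁻¹) * (2 * ρ₀ + 1) := by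
      have : 0 ≤ ρ₀⁻¹ := inv_nonneg.2 hρ
      nlinarith [mul_nonneg this hρ]
    have := mul_le_mul_of_nonneg_left h7 (add_nonneg hC₂ hC₃)
    linarith
  rw [Cstar]
  calc 4038 * (d : ℝ) * M ^ 3 * ((C₂ + C₃) * (1 + ρ₀) + 1)
      = 2 * (2019 * (d : ℝ) * M ^ 3) * ((C₂ + C₃) * (1 + ρ₀) + 1) := by ring
    _ ≤ _ := by gcongr

theorem rpow_neg_three_halves {l : ℝ} (hl : 0 ≤ l) : l ^ (-(3 / 2 : ℝ)) = (√l)⁻¹ ^ 3 := by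
  rw [Real.rpow_neg hl, inv_pow, Real.sqrt_eq_rpow, ← Real.rpow_natCast, ← Real.rpow_mul hl]
  norm_num

/-- The smoothing error and the logarithmically amplified Stein bound, at smoothing parameter
`1 / N ^ 2`, both fit below the explicit bound. Here `q` stands for `λ ^ (-3/2)`. -/
theorem error_le {d N : ℕ} (hd : 1 ≤ d) (hN : 1 ≤ N) {M ρ₀ C₁ C₂ C₃ R p q : ℝ} (hM : 1 ≤ M)
    (hρ : 0 ≤ ρ₀) (hC₁ : 0 ≤ C₁) (hC₂ : 0 ≤ C₂) (hC₃ : 0 ≤ C₃) (hR : 1 ≤ R)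
    (hp : 0 ≤ p) (hpq : p ^ 3 ≤ q) (hq : 1 ≤ (2 * M * N) ^ 3 * q) :
    2 * √d * ((N : ℝ) ^ 2)⁻¹
      + N * (31 * (C₂ + C₃) * (M * (p ^ 3 * (d + 1))) * (1 + ρ₀) * R)
        * Real.log ((N : ℝ) ^ 2)⁻¹⁻¹
      ≤ Cstar d M ρ₀ C₁ C₂ C₃ * N * (1 + Real.log N) * q * R := by
  have hd' : (1 : ℝ) ≤ d := by exact_mod_cast hd
  have hN' : (1 : ℝ) ≤ N := by exact_mod_cast hN
  have hq0 : 0 ≤ q := (pow_nonneg hp 3).trans hpq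
  have hlog : 0 ≤ Real.log N := Real.log_nonneg hN'
  rw [inv_inv, Real.log_pow]
  set l := Real.log N
  have hsd : √(d : ℝ) ≤ d := (Real.sqrt_le_left (by positivity)).2 (by nlinarith)
  have e1 : 2 * √d * ((N : ℝ) ^ 2)⁻¹ ≤ 4038 * d * M ^ 3 * 1 * N * (1 + l) * q * R := by
    -- `hq` expresses the a priori bound `λ ≤ (2MN)²`.
    have : ((N : ℝ) ^ 2)⁻¹ ≤ 8 * M ^ 3 * N * q := by
      rw [inv_le_iff_one_le_mul₀ (by positivity)]
      calc (1 : ℝ) ≤ (2 * M * N) ^ 3 * q := hq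
        _ = _ := by ring
    calc 2 * √d * ((N : ℝ) ^ 2)⁻¹ ≤ 2 * d * (8 * M ^ 3 * N * q) := by gcongr
      _ = 16 * d * M ^ 3 * 1 * N * 1 * q * 1 := by ring
      _ ≤ _ := by gcongr <;> linarith
  have e2 : N * (31 * (C₂ + C₃) * (M * (p ^ 3 * (d + 1))) * (1 + ρ₀) * R) * ((2 : ℕ) * l)
      ≤ 4038 * d * M ^ 3 * ((C₂ + C₃) * (1 + ρ₀)) * N * (1 + l) * q * R := by
    calc _ ≤ N * (31 * (C₂ + C₃) * (M * (q * (d + d))) * (1 + ρ₀) * R) * ((2 : ℕ) * l) := by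
          gcongr
      _ = 124 * d * M ^ 1 * ((C₂ + C₃) * (1 + ρ₀)) * N * l * q * R := by push_cast; ring
      _ ≤ _ := by
          gcongr
          · norm_num
          · norm_num
          · linarith
  calc _ ≤ 4038 * d * M ^ 3 * 1 * N * (1 + l) * q * R
        + 4038 * d * M ^ 3 * ((C₂ + C₃) * (1 + ρ₀)) * N * (1 + l) * q * R := add_le_add e1 e2
    _ = 4038 * d * M ^ 3 * ((C₂ + C₃) * (1 + ρ₀) + 1) * N * (1 + l) * q * R := by ring
    _ ≤ _ := by
        gcongr
        exact le_Cstar hd hM hρ hC₁ hC₂ hC₃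

end Constants

theorem mainTheorem2
    {X : Type*} [MeasurableSpace X] (μ : Measure X) [IsProbabilityMeasure μ]
    (d : ℕ) (hd : 1 ≤ d)
    (T : ℕ → X → X) (hT : ∀ i, 1 ≤ i → Measurable (T i))
    (g : ℕ → X → Vec d) (hg : ∀ i, Measurable (g i))
    (N : ℕ) (hN : 1 ≤ N)
    (M : ℝ) (hM : 1 ≤ M) (hgM : ∀ i < N, ∀ x, ‖g i x‖ ≤ M)
    (hlam : 1 < lambdaMin μ T g N)
    (ρ : ℕ → ℝ) (hρ_nonneg : ∀ n, 0 ≤ ρ n) (hρ_anti : Antitone ρ)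
    (hρ_lim : Tendsto ρ atTop (𝓝 0))
    (hρ_one : ρ 1 ≤ 1) (hρ_sum : 1 ≤ rhoSum N ρ)
    (C₁ C₂ C₃ : ℝ) (hC₁ : 0 < C₁) (hC₂ : 0 < C₂) (hC₃ : 0 < C₃)
    (h1 : CondC1 μ T g N ρ C₁)
    (h2 : CondC2 μ T g N M ρ C₂)
    (h3 : CondC3 μ T g N M ρ C₃) :
    wassersteinDist (μ.map (W μ T g N)) (stdGaussian (Vec d)) ≤
      ENNReal.ofReal
        (Cstar d M (ρ 0) C₁ C₂ C₃ * N * (1 + Real.log N) * lambdaMin μ T g N ^ (-(3 / 2 : ℝ))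
          * rhoSum N ρ) := by

  have hlam0 : 0 < lambdaMin μ T g N := by linarith
  have S : IsMixing μ T g N M ρ C₂ C₃ :=
    ⟨hT, hg, hM, hgM, hρ_nonneg, hC₂.le, hC₃.le, h2, h3⟩
  have hN2 : (1 : ℝ) ≤ (N : ℝ) ^ 2 := one_le_pow₀ (by exact_mod_cast hN)
  have hmeas := S.measurable_W
  have hprob : IsProbabilityMeasure (μ.map (W μ T g N)) :=
    Measure.isProbabilityMeasure_map hmeas.aemeasurable
  have hint : Integrable (fun y => ‖y‖) (μ.map (W μ T g N)) := by
    rw [integrable_map_measure (by fun_prop) hmeas.aemeasurable]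
    exact Integrable.of_bound hmeas.norm.aestronglyMeasurable _
      (ae_of_all _ fun x => by simpa using S.norm_W_le x)
  refine wassersteinDist_le_of_isSmoothTest hint integrable_norm_stdGaussian fun h K hh => ?_
  rw [integral_map hmeas.aemeasurable hh.contDiff.continuous.aestronglyMeasurable]
  refine (abs_integral_sub_le_of_deriv hh hmeas S.norm_W_le (S.integral_norm_sq_W hlam0).le
    (fun θ hθ => S.abs_deriv_interp_le hlam0 hN hρ_sum
      (sum_mul_le_rhoSum hρ_nonneg hρ_anti hρ_one) hh hθ)
    (σ := ((N : ℝ) ^ 2)⁻¹) (by positivity) (inv_le_one_of_one_le₀ hN2)).trans ?_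
  refine error_le hd hN hM (hρ_nonneg 0) hC₁.le hC₂.le hC₃.le hρ_sum (norm_nonneg _) ?_ ?_
  · rw [rpow_neg_three_halves hlam0.le]
    gcongr
    exact S.norm_inv_bMat_le hlam0
  · rw [rpow_neg_three_halves hlam0.le, ← mul_pow]
    refine one_le_pow₀ ?_
    have hs : √(lambdaMin μ T g N) ≤ 2 * M * N :=
      (Real.sqrt_le_left (by positivity)).2 (S.lambdaMin_le_sq hd)
    rw [← div_eq_mul_inv]
    exact (one_le_div (by positivity)).2 hs
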